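/- Let $D=\{(k,k): k\le -1\}\subset\mathbb Z^2$ and let $G_D$ be the Green's function of the square lattice $\mathbb Z^2$ (unit conductances, Laplacian $\Delta f(v)=\sum_{v'\sim v}(f(v)-f(v'))$) with Dirichlet boundary conditions on $D$; that is, $G_D(u,v)$ is the expected time spent at $v$, before hitting $D$, by the continuous-time random walk started at $u$ which crosses each edge at rate $1$. For integers $x,y$ with $y\ge 0$ and $x+y$ even put $$G_H(x,y)=2\,G_D\Big((0,0),\big(\tfrac{x-y}{2},\tfrac{x+y}{2}\big)\Big),$$ and put $G_H(x,y)=0$ when $x+y$ is odd. Let $c_x=2G_H(x,0)-G_H(x-1,1)-G_H(x+1,1)$ be the current entering the half-plane network at $(x,0)$. Square roots below are principal. Then $G_H$ is well defined and finite, and the following hold. 1. (Boundary conditions and harmonicity.) $G_H(x,0)=0$ for $x<0$; $c_0=1$ and $c_x=0$ for $x>0$; and for all $x$ and all $y\ge1$, $4G_H(x,y)=G_H(x+1,y+1)+G_H(x+1,y-1)+G_H(x-1,y+1)+G_H(x-1,y-1)$. 2. (Boundary generating functions.) $C(z)=\sum_{k\ge0}c_{-k}z^{-k}=\sqrt{1-1/z^2}$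 for $|z|>1$, and $V(z)=\sum_{k\ge0}G_H(2k,0)z^{2k}=1/\sqrt{1-z^2}$ for $|z|<1$. 3. (Vertical values.) $G_H(0,2k)+G_H(0,2k+2)=\sqrt2\,G_H(2k,0)$ for $k\ge0$, and $G_H(0,y)=G_H(-1,y-1)$ for $y>0$. 4. (Quadrant generating functions.) For $|z|<1$, $|w|<1$ the series $G_N=\sum_{x\ge0,\,y\ge0}G_H(x,y)z^xw^y$ converges absolutely and $$\Big(4-\tfrac wz-\tfrac zw-zw-\tfrac1{zw}\Big)G_N=\frac{\sqrt2\,(1-w/z)}{\sqrt{1-w^2}}+\frac{2-z/w-1/(zw)}{\sqrt{1-z^2}};$$ for $|z|>1$, $|w|<1$ the series $G_W=\sum_{x<0,\,y\ge0}G_H(x,y)z^xw^y$ converges absolutely and $$\Big(4-\tfrac wz-\tfrac zw-zw-\tfrac1{zw}\Big)G_W=\frac{\sqrt2\,(w/z-1)}{\sqrt{1-w^2}}+\sqrt{1-1/z^2}.$$ Both identities are understood after multiplication by $zw$ when $zw=0$; where the factor on the left is nonzero they give $G_N$ and $G_W$ in closed form. 5. (Algorithm.) For every $(x,y)$ with $y\ge0$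 and $x+y$ even, the value $G_H(x,y)$ is obtained in finitely many steps from the following data and rules, and these never produce a wrong value: the values $G_H(2k,0)$ ($k\ge0$) and the currents $c_{-2k}$ ($k\ge1$) read off as the coefficients of $V$ and $C$; the values $G_H(x,0)=0$ for $x<0$, and $c_0=1$, $c_x=0$ for $x>0$; the two relations in 3; and solving a harmonicity equation (at an interior vertex, or at an axis vertex with its known current) for one unknown value. In particular there is a computable function which sends $(x,y)\in\mathbb Z\times\mathbb Z_{\ge0}$ to integers $(a,b,n)$, $n\ge0$, with $G_H(x,y)=(a+b\sqrt2)/2^n$. 6. All values $G_H(x,y)$ lie in $\mathbb Z[\tfrac12][\sqrt2]$. -/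

import Mathlib

/-- The probability that simple random walk on `ℤ²` started at `u` is at `v` after `n` steps
without having visited the set `B` at any of the times `0, …, n`. -/
noncomputable def killedWalk (B : Set (ℤ × ℤ)) (u : ℤ × ℤ) : ℕ → ℤ × ℤ → ℝ
  | 0, v => by
      classical
      exact if v ∉ B ∧ v = u then 1 else 0
  | n + 1, v => by
      classical
      exact if v ∈ B then 0 else
        (killedWalk B u n (v.1 + 1, v.2) + killedWalk B u n (v.1 - 1, v.2) +
          killedWalk B u n (v.1, v.2 + 1) + killedWalk B u n (v.1, v.2 - 1)) / 4

/-- The Green's function of `ℤ²` (unit conductances, Laplacian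
`Δ f (v) = ∑_{v' ∼ v} (f v - f v')`) with Dirichlet boundary conditions on `B`: the expected time
spent at `v`, before reaching `B`, by the continuous-time walk started at `u` that crosses each
edge at rate `1`. Every visit lasts a mean time `1 / 4`. -/
noncomputable def dirichletGreen (B : Set (ℤ × ℤ)) (u v : ℤ × ℤ) : ℝ :=
  (∑' n : ℕ, killedWalk B u n v) / 4

/-- The slit: the negative diagonal. -/
def slit : Set (ℤ × ℤ) := {p | ∃ k : ℤ, k ≤ -1 ∧ p = (k, k)}

/-- The slit-plane Green's function with source at the origin, in the rotated coordinates in which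
the vertices are the points `(x, y)` with `x + y` even, and with current scaled by `2`.
At points with `x + y` odd, which are not vertices, it is given the value `0`. -/
noncomputable def GH (x y : ℤ) : ℝ :=
  if Even (x + y) then 2 * dirichletGreen slit (0, 0) ((x - y) / 2, (x + y) / 2) else 0

/-- The current entering the half-plane network (vertices `(x, y)`, `x + y` even, `y ≥ 0`, each
joined to `(x ± 1, y ± 1)` by a unit conductance) at the point `(x, 0)`, for the voltages `GH`. -/
noncomputable def boundaryCurrent (x : ℤ) : ℝ :=
  2 * GH x 0 - GH (x - 1) 1 - GH (x + 1) 1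

/-- The coefficient of `t ^ k` in `1 / √(1 - t)`. -/
noncomputable def invSqrtCoeff (k : ℕ) : ℝ := (Nat.centralBinom k : ℝ) / 4 ^ k

/-- The coefficient of `t ^ k` in `√(1 - t)`. -/
noncomputable def sqrtCoeff (k : ℕ) : ℝ :=
  -((Nat.centralBinom k : ℝ) / ((2 * (k : ℝ) - 1) * 4 ^ k))

/-- `HalfPlaneAlg x y a` says that the algorithm produces the value `a` at the vertex `(x, y)` in
finitely many steps. Its data are the values on the horizontal axis (coefficients of
`1 / √(1 - z²)` on the right, `0` on the left), the currents on the horizontal axis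
(`1` at the origin, `0` on the right, coefficients of `√(1 - 1 / z²)` on the left),
the vertical recurrence, and the relation between the columns `0` and `-1`.
Its remaining steps solve a harmonicity equation for one unknown value. -/
inductive HalfPlaneAlg : ℤ → ℤ → ℝ → Prop
  | axis (k : ℕ) : HalfPlaneAlg (2 * k) 0 (invSqrtCoeff k)
  | slit (k : ℕ) : HalfPlaneAlg (-(2 * (k + 1))) 0 0
  | vertical (k : ℕ) (a b : ℝ) : HalfPlaneAlg 0 (2 * k) a → HalfPlaneAlg (2 * k) 0 b →
      HalfPlaneAlg 0 (2 * k + 2) (√2 * b - a)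
  | offVertical (y : ℤ) (a : ℝ) : 0 < y → HalfPlaneAlg 0 y a → HalfPlaneAlg (-1) (y - 1) a
  | boundaryRight (x : ℤ) (a b : ℝ) : 0 ≤ x → HalfPlaneAlg x 0 a → HalfPlaneAlg (x - 1) 1 b →
      HalfPlaneAlg (x + 1) 1 (2 * a - b - if x = 0 then 1 else 0)
  | boundaryLeft (k : ℕ) (a b : ℝ) : 1 ≤ k → HalfPlaneAlg (-(2 * k)) 0 a →
      HalfPlaneAlg (-(2 * k) + 1) 1 b →
      HalfPlaneAlg (-(2 * k) - 1) 1 (2 * a - b - sqrtCoeff k)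
  | interiorRight (x y : ℤ) (a b c d : ℝ) : 1 ≤ y → HalfPlaneAlg x y a →
      HalfPlaneAlg (x - 1) (y - 1) b → HalfPlaneAlg (x - 1) (y + 1) c →
      HalfPlaneAlg (x + 1) (y - 1) d → HalfPlaneAlg (x + 1) (y + 1) (4 * a - b - c - d)
  | interiorLeft (x y : ℤ) (a b c d : ℝ) : 1 ≤ y → HalfPlaneAlg x y a →
      HalfPlaneAlg (x + 1) (y - 1) b → HalfPlaneAlg (x + 1) (y + 1) c →
      HalfPlaneAlg (x - 1) (y - 1) d → HalfPlaneAlg (x - 1) (y + 1) (4 * a - b - c - d)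

/-! The slit and the source are symmetric about the diagonal, so the Green's function folds to a
function on the rotated half plane: harmonic above the axis, zero on the negative axis, with a unit
current entering at the origin and none on the positive axis. This mixed boundary problem has the
explicit solution `voltage`, the real part of F(x,y) = (√2/π) ∫₀^π t^y u^x / (1 - it) dα with t =
cos α and u = (1 + it)/(t + i).

The identity u(t + i) = 1 + it is a discrete Cauchy-Riemann equation for every wave, hence for F
(`waveSum_cauchyRiemann`). F is real where x + y is even and imaginary elsewhere, so the voltage has
a harmonic conjugate on the other sublattice; eliminating it gives harmonicity, and boundary
currents are differences of its axis values. On the axis an exact derivative gives (n+1)F(n+1,0) =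
nF(n-1,0), and F(-1-x,y) = i·conj F(x,y) carries the values to the left: the central binomial
coefficients behind V and C.

F tends to 0 at infinity, by the decay of ∫|cos|^y and by the Riemann-Lebesgue lemma in x. The
maximum principle then identifies it with the Green's function (`hasSum_killedWalk`), which also
proves that the latter is finite.

The rest is algebra of F. The difference F(0,y) - iF(0,y+1) is an arcsine moment, whence the two
column relations. Summing harmonicity against z^x w^y over a quadrant leaves boundary terms that
these relations evaluate. The algorithm sweeps outwards from columns 0 and -1. Computability rests
on another scheme: multiplied by 2^(x+y), the Cauchy-Riemann equation is an integer recurrence for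
the coefficients of 1 and √2 (`two_pow_mul_conjPair`), and it is primitive recursive. -/

open Complex in
/-- The unimodular function `(1 + i t) / (t + i)` of a real `t`. -/
noncomputable def phase (t : ℝ) : ℂ := (1 + t * I) / (t + I)

open Complex in
/-- The discrete wave `t ^ y u ^ x / (1 - i t)`, where `u` is the phase of `t`. -/
noncomputable def wave (x : ℤ) (y : ℕ) (t : ℝ) : ℂ := (t : ℂ) ^ y * phase t ^ x / (1 - t * I)

/-- Superposition of the waves against the arcsine law. -/
noncomputable def waveSum (x : ℤ) (y : ℕ) : ℂ :=
  ((√2 / Real.pi : ℝ) : ℂ) * ∫ α in (0 : ℝ)..Real.pi, wave x y (Real.cos α)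

/-! ### Algebra of the discrete waves -/

section
open Complex

lemma add_I_ne_zero (t : ℝ) : (t : ℂ) + I ≠ 0 := fun h => by
  simpa using congrArg Complex.im h

lemma one_sub_mul_I_ne_zero (t : ℝ) : (1 : ℂ) - t * I ≠ 0 := fun h => by
  simpa using congrArg Complex.re h

lemma one_add_mul_I_ne_zero (t : ℝ) : (1 : ℂ) + t * I ≠ 0 := fun h => by
  simpa using congrArg Complex.re h

lemma phase_ne_zero (t : ℝ) : phase t ≠ 0 :=
  div_ne_zero (one_add_mul_I_ne_zero t) (add_I_ne_zero t)

lemma add_I_eq (t : ℝ) : (t : ℂ) + I = I * (1 - t * I) := by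
  linear_combination (t : ℂ) * I_sq

lemma phase_eq (t : ℝ) : phase t = -I * ((1 + t * I) / (1 - t * I)) := by
  rw [phase, add_I_eq, mul_comm I, ← div_div, div_eq_iff I_ne_zero]
  linear_combination ((1 + t * I) / (1 - t * I)) * I_sq

lemma norm_phase (t : ℝ) : ‖phase t‖ = 1 := by
  have h : (starRingEnd ℂ) (1 - t * I) = 1 + t * I := by simp
  rw [phase_eq, norm_mul, norm_div, ← h, norm_conj, div_self]
  · simp
  · simpa using one_sub_mul_I_ne_zero t

lemma conj_phase (t : ℝ) : (starRingEnd ℂ) (phase t) = (phase t)⁻¹ := by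
  rw [Complex.inv_def, Complex.normSq_eq_norm_sq, norm_phase]; simp

lemma phase_neg (t : ℝ) : phase (-t) = -(phase t)⁻¹ := by
  rw [phase_eq, phase_eq, mul_inv, inv_div, inv_neg, inv_I]
  push_cast
  ring

lemma continuous_phase : Continuous phase := by
  unfold phase
  exact Continuous.div (by fun_prop) (by fun_prop) add_I_ne_zero

lemma continuous_wave (x : ℤ) (y : ℕ) : Continuous (wave x y) := by
  unfold wave
  refine Continuous.div (Continuous.mul (by fun_prop) ?_) (by fun_prop) one_sub_mul_I_ne_zero
  exact continuous_phase.zpow₀ x fun t => Or.inl (phase_ne_zero t)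

lemma continuous_wave_cos (x : ℤ) (y : ℕ) : Continuous fun α : ℝ => wave x y (Real.cos α) :=
  (continuous_wave x y).comp Real.continuous_cos

lemma intervalIntegrable_wave_cos (x : ℤ) (y : ℕ) (a b : ℝ) :
    IntervalIntegrable (fun α : ℝ => wave x y (Real.cos α)) MeasureTheory.volume a b :=
  (continuous_wave_cos x y).intervalIntegrable a b

lemma wave_cauchyRiemann (x : ℤ) (y : ℕ) (t : ℝ) :
    wave (x + 1) (y + 1) t + I * wave (x + 1) y t = wave x y t + I * wave x (y + 1) t := by
  have h2 : phase t * (t + I) = 1 + t * I := div_mul_cancel₀ _ (add_I_ne_zero t)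
  simp only [wave, zpow_add_one₀ (phase_ne_zero t), pow_succ]
  linear_combination ((t : ℂ) ^ y * phase t ^ x / (1 - t * I)) * h2

/-- Conjugation amounts to t ↦ -t up to sign. The arcsine law is symmetric, so this makes the
superposition real or imaginary according to the parity of x + y. -/
lemma conj_wave (x : ℤ) (y : ℕ) (t : ℝ) :
    (starRingEnd ℂ) (wave x y t) = (-1) ^ (x + y) * wave x y (-t) := by
  have h1 : (-1 : ℂ) ^ (x + y) = (-1) ^ x * (-1) ^ y := by
    rw [zpow_add₀ (by norm_num), zpow_natCast]
  have h2 : (-1 : ℂ) ^ x * (-1) ^ x = 1 := by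
    rw [← zpow_add₀ (by norm_num)]; exact Even.neg_one_zpow ⟨x, rfl⟩
  have h3 : (-1 : ℂ) ^ y * (-1) ^ y = 1 := by
    rw [← pow_add]; exact Even.neg_one_pow ⟨y, rfl⟩
  simp only [wave, map_div₀, map_mul, map_pow, map_zpow₀, conj_phase, conj_ofReal, phase_neg,
    h1, map_sub, map_one, conj_I]
  have e1 : (-(phase t)⁻¹) ^ x = (-1) ^ x * (phase t)⁻¹ ^ x := by rw [← mul_zpow]; simp
  have e2 : ((-t : ℝ) : ℂ) ^ y = (-1) ^ y * (t : ℂ) ^ y := by rw [← mul_pow]; simp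
  rw [e1, e2]
  have e3 : (1 : ℂ) - t * -I = 1 - (-t : ℝ) * I := by push_cast; ring
  rw [e3]
  linear_combination (-(t : ℂ) ^ y * (phase t)⁻¹ ^ x / (1 - (-t : ℝ) * I)) *
    ((-1 : ℂ) ^ y * (-1) ^ y * h2 + h3)

/-- Conjugation inverts u and turns 1/(1 - it) into 1/(1 + it); the spare factor u⁻¹ = i(1 - it)/(1
+ it) repairs the denominator. This reflection determines the left half of the plane from the right
half. -/
lemma wave_neg_sub_one (x : ℤ) (y : ℕ) (t : ℝ) :
    wave (-x - 1) y t = I * (starRingEnd ℂ) (wave x y t) := by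
  have h1 := one_sub_mul_I_ne_zero t
  have h2 := one_add_mul_I_ne_zero t
  simp only [wave, map_div₀, map_mul, map_pow, map_zpow₀, conj_phase, conj_ofReal,
    map_sub, map_one, conj_I]
  rw [sub_eq_add_neg, zpow_add₀ (phase_ne_zero t), zpow_neg, ← inv_zpow, zpow_neg_one]
  rw [show (1 : ℂ) - t * -I = 1 + t * I by ring]
  have : (phase t)⁻¹ = I * (1 - t * I) / (1 + t * I) := by
    rw [phase, inv_div, add_I_eq]
  nth_rewrite 2 [this]
  generalize (phase t)⁻¹ ^ x = p
  generalize (1 : ℂ) - t * I = a at h1 ⊢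
  generalize (1 : ℂ) + t * I = b at h2 ⊢
  field_simp

/-- The factor 1/(1 - it) cancels here, so column 0 is governed by plain moments of the arcsine law.
-/
lemma wave_zero_sub (y : ℕ) (t : ℝ) : wave 0 y t - I * wave 0 (y + 1) t = (t : ℂ) ^ y := by
  have h1 := one_sub_mul_I_ne_zero t
  simp only [wave, zpow_zero, pow_succ]
  field_simp

lemma norm_wave_le (x : ℤ) (y : ℕ) (t : ℝ) : ‖wave x y t‖ ≤ |t| ^ y := by
  have h : 1 ≤ ‖(1 : ℂ) - t * I‖ := by
    refine le_trans ?_ (Complex.abs_re_le_norm _)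
    simp
  rw [wave, norm_div, norm_mul, norm_zpow, norm_phase, one_zpow, mul_one, norm_pow, norm_real,
    Real.norm_eq_abs]
  exact div_le_self (by positivity) h

/-! ### Linear relations between the superpositions -/

lemma waveSum_cauchyRiemann (x : ℤ) (y : ℕ) :
    waveSum (x + 1) (y + 1) + I * waveSum (x + 1) y = waveSum x y + I * waveSum x (y + 1) := by
  have h : (∫ α in (0 : ℝ)..Real.pi, (wave (x + 1) (y + 1) (Real.cos α) +
      I * wave (x + 1) y (Real.cos α))) = ∫ α in (0 : ℝ)..Real.pi, (wave x y (Real.cos α) +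
      I * wave x (y + 1) (Real.cos α)) := by
    simp only [wave_cauchyRiemann]
  rw [intervalIntegral.integral_add (intervalIntegrable_wave_cos _ _ _ _)
    ((intervalIntegrable_wave_cos _ _ _ _).const_mul _),
    intervalIntegral.integral_add (intervalIntegrable_wave_cos _ _ _ _)
    ((intervalIntegrable_wave_cos _ _ _ _).const_mul _),
    intervalIntegral.integral_const_mul, intervalIntegral.integral_const_mul] at h
  simp only [waveSum]
  linear_combination ((√2 / Real.pi : ℝ) : ℂ) * h

lemma intervalIntegral_conj (f : ℝ → ℂ) (a b : ℝ) :
    ∫ α in a..b, (starRingEnd ℂ) (f α) = (starRingEnd ℂ) (∫ α in a..b, f α) := by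
  simp only [intervalIntegral, integral_conj, map_sub]

lemma conj_waveSum (x : ℤ) (y : ℕ) :
    (starRingEnd ℂ) (waveSum x y) = (-1) ^ (x + y) * waveSum x y := by
  -- The substitution α ↦ π - α changes the sign of cos α.
  have h : ∫ α in (0 : ℝ)..Real.pi, wave x y (-Real.cos α) =
      ∫ α in (0 : ℝ)..Real.pi, wave x y (Real.cos α) := by
    have := intervalIntegral.integral_comp_sub_left (a := 0) (b := Real.pi)
      (fun α => wave x y (Real.cos α)) Real.pi
    simpa [Real.cos_pi_sub] using this
  rw [waveSum, map_mul, conj_ofReal, ← intervalIntegral_conj]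
  simp only [conj_wave]
  rw [intervalIntegral.integral_const_mul, h]
  ring

lemma waveSum_neg_sub_one (x : ℤ) (y : ℕ) :
    waveSum (-x - 1) y = I * (starRingEnd ℂ) (waveSum x y) := by
  simp only [waveSum, wave_neg_sub_one]
  rw [map_mul, conj_ofReal, ← intervalIntegral_conj, intervalIntegral.integral_const_mul]
  ring

lemma waveSum_im_of_even {x : ℤ} {y : ℕ} (h : Even (x + y)) : (waveSum x y).im = 0 := by
  have := conj_waveSum x y
  rw [h.neg_one_zpow, one_mul] at this
  exact Complex.conj_eq_iff_im.1 this

lemma waveSum_re_of_odd {x : ℤ} {y : ℕ} (h : Odd (x + y)) : (waveSum x y).re = 0 := by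
  have := congrArg Complex.re (conj_waveSum x y)
  rw [h.neg_one_zpow] at this
  simp at this
  linarith

/-! ### The moments of the arcsine law -/

lemma integral_cos_pow_add_two (n : ℕ) : ∫ α in (0 : ℝ)..Real.pi, Real.cos α ^ (n + 2) =
    (n + 1) / (n + 2) * ∫ α in (0 : ℝ)..Real.pi, Real.cos α ^ n := by
  rw [integral_cos_pow]; simp

lemma integral_cos_pow_even (k : ℕ) : ∫ α in (0 : ℝ)..Real.pi, Real.cos α ^ (2 * k) =
    Real.pi * invSqrtCoeff k := by
  induction k with
  | zero => simp [invSqrtCoeff]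
  | succ k ih =>
    have h := Nat.succ_mul_centralBinom_succ k
    have h' : ((k : ℝ) + 1) * (k + 1).centralBinom = 2 * (2 * k + 1) * k.centralBinom := by
      exact_mod_cast h
    rw [show 2 * (k + 1) = 2 * k + 2 by ring, integral_cos_pow_add_two, ih, invSqrtCoeff,
      invSqrtCoeff, pow_succ]
    push_cast
    field_simp
    linear_combination (-2) * h'

lemma integral_cos_pow_odd (k : ℕ) : ∫ α in (0 : ℝ)..Real.pi, Real.cos α ^ (2 * k + 1) = 0 := by
  induction k with
  | zero => simp
  | succ k ih =>
    rw [show 2 * (k + 1) + 1 = 2 * k + 1 + 2 by ring, integral_cos_pow_add_two, ih, mul_zero]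

lemma waveSum_zero_sub (y : ℕ) : waveSum 0 y - I * waveSum 0 (y + 1) =
    ((√2 / Real.pi * ∫ α in (0 : ℝ)..Real.pi, Real.cos α ^ y : ℝ) : ℂ) := by
  have h : ∫ α in (0 : ℝ)..Real.pi, (wave 0 y (Real.cos α) - I * wave 0 (y + 1) (Real.cos α)) =
      ∫ α in (0 : ℝ)..Real.pi, ((Real.cos α ^ y : ℝ) : ℂ) := by
    simp only [wave_zero_sub, ofReal_pow]
  rw [intervalIntegral.integral_sub (intervalIntegrable_wave_cos _ _ _ _)
    ((intervalIntegrable_wave_cos _ _ _ _).const_mul _),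
    intervalIntegral.integral_const_mul, intervalIntegral.integral_ofReal] at h
  simp only [waveSum]
  rw [ofReal_mul, ← h]
  ring

lemma waveSum_zero_even_sub (k : ℕ) : waveSum 0 (2 * k) - I * waveSum 0 (2 * k + 1) =
    ((√2 * invSqrtCoeff k : ℝ) : ℂ) := by
  rw [waveSum_zero_sub, integral_cos_pow_even]
  congr 1
  field_simp

lemma waveSum_zero_odd (k : ℕ) : waveSum 0 (2 * k + 1) = I * waveSum 0 (2 * k + 2) := by
  have := waveSum_zero_sub (2 * k + 1)
  rw [integral_cos_pow_odd, mul_zero, ofReal_zero] at this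
  exact sub_eq_zero.1 this

end

section
open Complex

/-! ### Values on the horizontal axis -/

lemma hasDerivAt_phase_cos (α : ℝ) : HasDerivAt (fun α : ℝ => phase (Real.cos α))
    (2 * Real.sin α / ((Real.cos α : ℂ) + I) ^ 2) α := by
  have hc : HasDerivAt (fun α : ℝ => (Real.cos α : ℂ)) (-Real.sin α : ℝ) α :=
    (Real.hasDerivAt_cos α).ofReal_comp
  have h := ((hc.mul_const I).const_add 1).fun_div (hc.add_const I) (add_I_ne_zero _)
  refine h.congr_deriv ?_
  congr 1
  rw [ofReal_neg]
  linear_combination (-(Real.sin α : ℂ)) * I_sq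

/-- The function is chosen to vanish at 0 and π, so that integrating its derivative yields the
two-term recurrence on the axis. The computation rests on 2 sin²α/(t + i)² = u² - 1 and u(1 - it) =
t - i. -/
lemma hasDerivAt_phase_zpow_mul_sin (n : ℤ) (α : ℝ) :
    HasDerivAt (fun α : ℝ => phase (Real.cos α) ^ n * Real.sin α / (1 - Real.cos α * I))
      ((n + 1) * wave (n + 1) 0 (Real.cos α) - n * wave (n - 1) 0 (Real.cos α)) α := by
  have hc : HasDerivAt (fun α : ℝ => (Real.cos α : ℂ)) (-Real.sin α : ℝ) α :=
    (Real.hasDerivAt_cos α).ofReal_comp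
  have hs : HasDerivAt (fun α : ℝ => (Real.sin α : ℂ)) (Real.cos α : ℝ) α :=
    (Real.hasDerivAt_sin α).ofReal_comp
  have hu0 := phase_ne_zero (Real.cos α)
  have hz := (hasDerivAt_zpow n (phase (Real.cos α)) (Or.inl hu0)).comp α (hasDerivAt_phase_cos α)
  have h := (hz.fun_mul hs).fun_div ((hc.mul_const I).const_sub 1) (one_sub_mul_I_ne_zero _)
  refine h.congr_deriv ?_
  have hd := one_sub_mul_I_ne_zero (Real.cos α)
  have hb := add_I_ne_zero (Real.cos α)
  have hsq : (Real.sin α : ℂ) ^ 2 + (Real.cos α : ℂ) ^ 2 = 1 := by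
    exact_mod_cast Real.sin_sq_add_cos_sq α
  have hu : phase (Real.cos α) * (Real.cos α + I) = 1 + Real.cos α * I :=
    div_mul_cancel₀ _ (add_I_ne_zero _)
  have hu' : phase (Real.cos α) * (1 - Real.cos α * I) = Real.cos α - I := by
    linear_combination (-I) * hu + phase (Real.cos α) * I_sq - Real.cos α * I_sq
  have e1 : phase (Real.cos α) ^ n = phase (Real.cos α) ^ (n - 1) * phase (Real.cos α) := by
    rw [← zpow_add_one₀ hu0]; congr 1; ring
  have e2 : phase (Real.cos α) ^ (n + 1) =
      phase (Real.cos α) ^ (n - 1) * phase (Real.cos α) ^ 2 := by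
    rw [zpow_add_one₀ hu0, e1]; ring
  have e3 : 2 * (Real.sin α : ℂ) ^ 2 / (Real.cos α + I) ^ 2 = phase (Real.cos α) ^ 2 - 1 := by
    rw [div_eq_iff (pow_ne_zero 2 hb)]
    linear_combination 2 * hsq - (phase (Real.cos α) * (Real.cos α + I) + 1 + Real.cos α * I) * hu
      + (1 - (Real.cos α : ℂ) ^ 2) * I_sq
  have e4 : (Real.cos α * (1 - Real.cos α * I) - Real.sin α * (Real.sin α * I) : ℂ) =
      phase (Real.cos α) * (1 - Real.cos α * I) := by
    linear_combination -hu' - I * hsq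
  simp only [wave, pow_zero, one_mul, Function.comp_apply]
  rw [e1, e2]
  generalize phase (Real.cos α) ^ (n - 1) = p at *
  generalize phase (Real.cos α) = u at *
  have : ((n : ℂ) * p * (2 * Real.sin α / (Real.cos α + I) ^ 2) * Real.sin α +
      p * u * (Real.cos α : ℝ)) * (1 - Real.cos α * I) -
      p * u * Real.sin α * -((-Real.sin α : ℝ) * I) =
      n * p * (2 * (Real.sin α : ℂ) ^ 2 / (Real.cos α + I) ^ 2) * (1 - Real.cos α * I) +
      p * u * (Real.cos α * (1 - Real.cos α * I) - Real.sin α * (Real.sin α * I) : ℂ) := by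
    push_cast; ring
  rw [this, e3, e4]
  field_simp
  ring

lemma waveSum_axis_succ (n : ℤ) : (n + 1) * waveSum (n + 1) 0 = n * waveSum (n - 1) 0 := by
  have h := intervalIntegral.integral_eq_sub_of_hasDerivAt (a := 0) (b := Real.pi)
    (fun α _ => hasDerivAt_phase_zpow_mul_sin n α)
    (((intervalIntegrable_wave_cos _ _ _ _).const_mul _).sub
      ((intervalIntegrable_wave_cos _ _ _ _).const_mul _))
  rw [intervalIntegral.integral_sub ((intervalIntegrable_wave_cos _ _ _ _).const_mul _)
    ((intervalIntegrable_wave_cos _ _ _ _).const_mul _), intervalIntegral.integral_const_mul,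
    intervalIntegral.integral_const_mul] at h
  simp only [Real.sin_pi, Real.sin_zero, ofReal_zero, mul_zero, zero_div, sub_zero] at h
  simp only [waveSum]
  linear_combination ((√2 / Real.pi : ℝ) : ℂ) * h

/-- With β = 2α the integrand is 2/(3 + cos β), and |1 + q e^{iβ}|² = 2q(3 + cos β) for the root q =
3 - 2√2 of q² - 6q + 1. Subtracting arg(1 + q e^{iβ}) from α gives a global antiderivative up to the
factor √2: since 0 < q < 1 the real part stays positive and the arctangent has no jump on [0, π]. -/
lemma integral_inv_one_add_cos_sq :
    ∫ α in (0 : ℝ)..Real.pi, 1 / (1 + Real.cos α ^ 2) = Real.pi / √2 := by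
  have h2 : √2 ^ 2 = 2 := Real.sq_sqrt (by norm_num)
  have h0 : 0 < √2 := by positivity
  have hlt : √2 < 3 / 2 := by nlinarith
  have hgt : 1 < √2 := by nlinarith
  have hpos : ∀ β : ℝ, 0 < 1 + (3 - 2 * √2) * Real.cos β := fun β => by
    have := Real.neg_one_le_cos β
    nlinarith
  have hd : ∀ α : ℝ, HasDerivAt (fun α : ℝ => (α - Real.arctan ((3 - 2 * √2) * Real.sin (2 * α) /
      (1 + (3 - 2 * √2) * Real.cos (2 * α)))) / √2) (1 / (1 + Real.cos α ^ 2)) α := fun α => by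
    have hl : HasDerivAt (fun α : ℝ => 2 * α) 2 α := by simpa using (hasDerivAt_id α).const_mul 2
    have h := (((hl.sin.const_mul (3 - 2 * √2)).fun_div
      ((hl.cos.const_mul (3 - 2 * √2)).const_add 1) (hpos _).ne').arctan)
    refine (((hasDerivAt_id α).sub h).div_const √2).congr_deriv ?_
    have hp := (hpos (2 * α)).ne'
    have hsc := Real.sin_sq_add_cos_sq (2 * α)
    have hc : Real.cos α ^ 2 = (1 + Real.cos (2 * α)) / 2 := by
      rw [Real.cos_two_mul]; ring
    have h3 : 0 < 3 + Real.cos (2 * α) := by linarith [Real.neg_one_le_cos (2 * α)]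
    rw [hc]
    generalize Real.cos (2 * α) = c at *
    generalize Real.sin (2 * α) = s at *
    have hs : s ^ 2 = 1 - c ^ 2 := by linarith
    have e1 : 1 + ((3 - 2 * √2) * s / (1 + (3 - 2 * √2) * c)) ^ 2 =
        (3 - 2 * √2) * (6 + 2 * c) / (1 + (3 - 2 * √2) * c) ^ 2 := by
      field_simp
      rw [hs]
      linear_combination (4 : ℝ) * h2
    have e2 : (3 - 2 * √2) * (c * 2) * (1 + (3 - 2 * √2) * c) -
        (3 - 2 * √2) * s * ((3 - 2 * √2) * (-s * 2)) = 2 * (3 - 2 * √2) * (c + (3 - 2 * √2)) := by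
      linear_combination (2 * (3 - 2 * √2) ^ 2) * hs
    have hq : 3 - 2 * √2 ≠ 0 := by linarith
    have e3 : 6 + 2 * c = 2 * (3 + c) := by ring
    have e4 : 1 + (1 + c) / 2 = (3 + c) / 2 := by ring
    rw [e1, e2, e3, e4]
    field_simp
    ring
  rw [intervalIntegral.integral_eq_sub_of_hasDerivAt (fun α _ => hd α)]
  · simp
  · refine Continuous.intervalIntegrable ?_ _ _
    exact Continuous.div (by fun_prop) (by fun_prop) fun α => by positivity

lemma waveSum_zero_zero : waveSum 0 0 = 1 := by
  have him : (waveSum 0 0).im = 0 := waveSum_im_of_even (by simp)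
  have hre : (waveSum 0 0).re = 1 := by
    have h : (∫ α in (0 : ℝ)..Real.pi, wave 0 0 (Real.cos α)).re =
        ∫ α in (0 : ℝ)..Real.pi, 1 / (1 + Real.cos α ^ 2) := by
      have := Complex.reCLM.intervalIntegral_comp_comm (intervalIntegrable_wave_cos 0 0 0 Real.pi)
      simp only [reCLM_apply] at this
      rw [← this]
      congr 1
      ext α
      simp [wave, Complex.normSq_apply, -ofReal_cos]
      ring
    rw [waveSum, re_ofReal_mul, h, integral_inv_one_add_cos_sq]
    field_simp
  exact Complex.ext hre him

lemma waveSum_axis_even (k : ℕ) : waveSum (2 * k) 0 = invSqrtCoeff k := by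
  induction k with
  | zero => simp [waveSum_zero_zero, invSqrtCoeff]
  | succ k ih =>
    have h := waveSum_axis_succ (2 * k + 1)
    rw [show (2 * (k : ℤ) + 1 - 1) = 2 * k by ring, ih] at h
    have h1 : ((k : ℂ) + 1) * (k + 1).centralBinom = 2 * (2 * k + 1) * k.centralBinom := by
      exact_mod_cast Nat.succ_mul_centralBinom_succ k
    have h2 : ((2 * (k : ℤ) + 1 : ℤ) : ℂ) + 1 ≠ 0 := by
      norm_cast
    have h3 : (k : ℂ) + 1 ≠ 0 := by norm_cast
    have e : (2 * ((k + 1 : ℕ) : ℤ)) = 2 * (k : ℤ) + 1 + 1 := by push_cast; ring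
    rw [e]
    apply mul_left_cancel₀ h2
    rw [h, invSqrtCoeff, invSqrtCoeff, pow_succ]
    push_cast
    field_simp
    linear_combination (-2) * h1

lemma waveSum_axis_odd (k : ℕ) : waveSum (2 * k + 1) 0 = 0 := by
  induction k with
  | zero => simpa using waveSum_axis_succ 0
  | succ k ih =>
    have h := waveSum_axis_succ (2 * k + 2)
    rw [show (2 * (k : ℤ) + 2 - 1) = 2 * k + 1 by ring, ih, mul_zero] at h
    have h2 : ((2 * (k : ℤ) + 2 : ℤ) : ℂ) + 1 ≠ 0 := by norm_cast
    have := (mul_eq_zero.1 h).resolve_left h2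
    convert this using 2
    push_cast; ring

lemma waveSum_axis_neg_even (k : ℕ) : waveSum (-(2 * (k + 1))) 0 = 0 := by
  have h := waveSum_neg_sub_one (2 * k + 1) 0
  rw [waveSum_axis_odd, map_zero, mul_zero] at h
  rw [← h]; congr 1

lemma waveSum_axis_neg_odd (k : ℕ) : waveSum (-(2 * k) - 1) 0 = I * invSqrtCoeff k := by
  rw [waveSum_neg_sub_one, waveSum_axis_even, conj_ofReal]

end

section
open Complex Filter Topology MeasureTheory

/-! ### Decay at infinity -/

lemma norm_waveSum_le_integral (x : ℤ) (y : ℕ) :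
    ‖waveSum x y‖ ≤ √2 / Real.pi * ∫ α in (0 : ℝ)..Real.pi, |Real.cos α| ^ y := by
  rw [waveSum, norm_mul, norm_real, Real.norm_of_nonneg (by positivity)]
  gcongr
  exact intervalIntegral.norm_integral_le_of_norm_le Real.pi_pos.le
    (ae_of_all _ fun α _ => norm_wave_le x y _)
    (Continuous.intervalIntegrable (by fun_prop) _ _)

lemma norm_waveSum_le (x : ℤ) (y : ℕ) : ‖waveSum x y‖ ≤ √2 := by
  refine (norm_waveSum_le_integral x y).trans ?_
  have h : ∫ α in (0 : ℝ)..Real.pi, |Real.cos α| ^ y ≤ ∫ _ in (0 : ℝ)..Real.pi, (1 : ℝ) :=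
    intervalIntegral.integral_mono_on Real.pi_pos.le
      (Continuous.intervalIntegrable (by fun_prop) _ _) (by simp)
      fun α _ => pow_le_one₀ (abs_nonneg _) (Real.abs_cos_le_one α)
  calc _ ≤ √2 / Real.pi * ∫ _ in (0 : ℝ)..Real.pi, (1 : ℝ) := by gcongr
    _ = √2 := by simp

lemma tendsto_integral_abs_cos_pow :
    Tendsto (fun y : ℕ => ∫ α in (0 : ℝ)..Real.pi, |Real.cos α| ^ y) atTop (𝓝 0) := by
  have h := intervalIntegral.tendsto_integral_filter_of_dominated_convergence
    (μ := volume) (a := 0) (b := Real.pi) (l := atTop)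
    (F := fun (y : ℕ) (α : ℝ) => |Real.cos α| ^ y) (f := fun _ => (0 : ℝ)) (fun _ => (1 : ℝ))
    (Eventually.of_forall fun y => by
      apply Continuous.aestronglyMeasurable; fun_prop)
    (Eventually.of_forall fun y => ae_of_all _ fun α _ => by
      rw [Real.norm_eq_abs, abs_pow, abs_abs]
      exact pow_le_one₀ (abs_nonneg _) (Real.abs_cos_le_one α))
    (by simp)
    (by
      -- The half-open interval contains π, where |cos α| = 1 and the powers do not decay.
      filter_upwards [Measure.ae_ne volume Real.pi] with α hα hmem
      rw [Set.uIoc_of_le Real.pi_pos.le] at hmem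
      have hlt : α < Real.pi := lt_of_le_of_ne hmem.2 hα
      have hs := Real.sin_pos_of_pos_of_lt_pi hmem.1 hlt
      apply tendsto_pow_atTop_nhds_zero_of_lt_one (abs_nonneg _)
      rw [← sq_lt_one_iff_abs_lt_one]
      nlinarith [Real.sin_sq_add_cos_sq α])
  simpa using h

lemma phase_tan {v : ℝ} (hv : Real.cos v ≠ 0) :
    phase (Real.tan v) = -I * exp (2 * v * I) := by
  have hc : (Real.cos v : ℂ) ≠ 0 := by exact_mod_cast hv
  have e1 : exp (2 * v * I) = exp (v * I) / exp (-v * I) := by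
    rw [← Complex.exp_sub]; congr 1; ring
  have e2 : exp (v * I) = Real.cos v * (1 + Real.tan v * I) := by
    rw [exp_mul_I, Real.tan_eq_sin_div_cos]
    push_cast at hc ⊢
    field_simp
  have e3 : exp (-v * I) = Real.cos v * (1 - Real.tan v * I) := by
    rw [exp_mul_I, Real.tan_eq_sin_div_cos, Complex.cos_neg, Complex.sin_neg]
    push_cast at hc ⊢
    field_simp
    ring
  rw [phase_eq, e1, e2, e3, mul_div_mul_left _ _ hc]

/-- The density of the superposition of the waves of index `y` in the variable
`arctan (cos α)`. -/
noncomputable def arctanDensity (y : ℕ) (v : ℝ) : ℂ :=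
  ((Real.tan v ^ y * (1 + Real.tan v ^ 2) / √(1 - Real.tan v ^ 2) : ℝ) : ℂ) /
    (1 - Real.tan v * I)

/-- In the variable v = arctan(cos α) the phase is -i e^{2iv}, so the superposition becomes a
Fourier integral in x, to which the Riemann-Lebesgue lemma applies. -/
lemma integral_wave_cos_eq (x : ℤ) (y : ℕ) :
    ∫ α in (0 : ℝ)..Real.pi, wave x y (Real.cos α) =
      ∫ v in (fun α => Real.arctan (Real.cos α)) '' Set.Ioo 0 Real.pi,
        phase (Real.tan v) ^ x * arctanDensity y v := by
  have hd : ∀ α ∈ Set.Ioo 0 Real.pi, HasDerivWithinAt (fun α => Real.arctan (Real.cos α))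
      (1 / (1 + Real.cos α ^ 2) * -Real.sin α) (Set.Ioo 0 Real.pi) α := fun α _ =>
    (Real.hasDerivAt_cos α).arctan.hasDerivWithinAt
  have hinj : Set.InjOn (fun α => Real.arctan (Real.cos α)) (Set.Ioo 0 Real.pi) := by
    intro a ha b hb hab
    exact Real.injOn_cos (Set.Ioo_subset_Icc_self ha) (Set.Ioo_subset_Icc_self hb)
      (Real.arctan_injective hab)
  rw [integral_image_eq_integral_abs_deriv_smul measurableSet_Ioo hd hinj,
    intervalIntegral.integral_of_le Real.pi_pos.le, integral_Ioc_eq_integral_Ioo]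
  refine setIntegral_congr_fun measurableSet_Ioo fun α hα => ?_
  have hs := Real.sin_pos_of_pos_of_lt_pi hα.1 hα.2
  have h1 : √(1 - Real.cos α ^ 2) = Real.sin α := by
    rw [← Real.sin_sq, Real.sqrt_sq hs.le]
  have h2 : |1 / (1 + Real.cos α ^ 2) * -Real.sin α| = Real.sin α / (1 + Real.cos α ^ 2) := by
    rw [mul_neg, abs_neg, abs_of_nonneg (by positivity)]; ring
  simp only [Real.tan_arctan, arctanDensity, h1, h2, wave, real_smul]
  have h3 : (Real.sin α : ℂ) ≠ 0 := by exact_mod_cast hs.ne'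
  have h4 : (1 + (Real.cos α : ℂ) ^ 2) ≠ 0 := by
    have : 1 + Real.cos α ^ 2 ≠ 0 := by positivity
    exact_mod_cast this
  simp only [ofReal_div, ofReal_mul, ofReal_pow, ofReal_add, ofReal_one]
  field_simp

lemma norm_waveSum_eq (x : ℤ) (y : ℕ) : ‖waveSum x y‖ = √2 / Real.pi *
    ‖∫ v : ℝ, Real.fourierChar (-(v * (-x / Real.pi))) •
      ((fun α => Real.arctan (Real.cos α)) '' Set.Ioo 0 Real.pi).indicator
        (arctanDensity y) v‖ := by
  have hm : MeasurableSet ((fun α => Real.arctan (Real.cos α)) '' Set.Ioo 0 Real.pi) := by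
    apply measurableSet_Ioo.image_of_continuousOn_injOn
    · fun_prop
    · intro a ha b hb hab
      exact Real.injOn_cos (Set.Ioo_subset_Icc_self ha) (Set.Ioo_subset_Icc_self hb)
        (Real.arctan_injective hab)
  rw [waveSum, norm_mul, norm_real, Real.norm_of_nonneg (by positivity), integral_wave_cos_eq]
  congr 1
  have h : ∀ v ∈ (fun α => Real.arctan (Real.cos α)) '' Set.Ioo 0 Real.pi,
      phase (Real.tan v) ^ x * arctanDensity y v =
        (-I) ^ x * (Real.fourierChar (-(v * (-x / Real.pi))) • arctanDensity y v) := by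
    rintro _ ⟨α, _, rfl⟩
    -- The additive character is s ↦ exp(2πis), so the frequency -x/π gives exp(2ixv).
    rw [phase_tan (Real.cos_arctan_pos _).ne', mul_zpow, ← Complex.exp_int_mul,
      Circle.smul_def, Real.fourierChar_apply, smul_eq_mul, mul_assoc]
    congr 3
    push_cast
    have : (Real.pi : ℂ) ≠ 0 := by exact_mod_cast Real.pi_ne_zero
    field_simp
  rw [setIntegral_congr_fun hm h, integral_const_mul, norm_mul, norm_zpow, norm_neg, norm_I,
    one_zpow, one_mul, ← integral_indicator hm]
  congr 2
  ext v
  by_cases hv : v ∈ (fun α => Real.arctan (Real.cos α)) '' Set.Ioo 0 Real.pi <;> simp [hv]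

lemma tendsto_waveSum_cofinite (y : ℕ) :
    Tendsto (fun x : ℤ => waveSum x y) cofinite (𝓝 0) := by
  have h1 : Tendsto (fun x : ℤ => -(x : ℝ) / Real.pi) cofinite (cocompact ℝ) := by
    have h : Tendsto (fun x : ℤ => (x : ℝ)) cofinite (cocompact ℝ) :=
      Int.tendsto_coe_cofinite
    have h2 := (Homeomorph.mulRight₀ (-1 / Real.pi)
      (by positivity)).isClosedEmbedding.tendsto_cocompact
    refine (h2.comp h).congr fun x => ?_
    simp; ring
  -- No integrability of the density has to be supplied: integrals of nonintegrable functions are 0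
  -- by convention.
  have h2 := (Real.tendsto_integral_exp_smul_cocompact
    (((fun α => Real.arctan (Real.cos α)) '' Set.Ioo 0 Real.pi).indicator
        (arctanDensity y))).comp h1
  rw [tendsto_zero_iff_norm_tendsto_zero] at h2 ⊢
  have h3 := h2.const_mul (√2 / Real.pi)
  rw [mul_zero] at h3
  exact h3.congr fun x => (norm_waveSum_eq x y).symm

/-- The bound in y is uniform in x, so only finitely many rows matter, and each of them decays in x.
-/
lemma finite_le_norm_waveSum {ε : ℝ} (hε : 0 < ε) :
    {p : ℤ × ℕ | ε ≤ ‖waveSum p.1 p.2‖}.Finite := by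
  have h := (tendsto_integral_abs_cos_pow.const_mul (√2 / Real.pi))
  rw [mul_zero] at h
  obtain ⟨Y, hY⟩ := eventually_atTop.1 (h.eventually_lt_const hε)
  have hfin : ∀ y : ℕ, {x : ℤ | ε ≤ ‖waveSum x y‖}.Finite := fun y => by
    have h := (tendsto_zero_iff_norm_tendsto_zero.1
      (tendsto_waveSum_cofinite y)).eventually_lt_const hε
    simpa only [Filter.eventually_cofinite, not_lt] using h
  refine ((Set.finite_Iio Y).biUnion fun y _ =>
    (hfin y).image fun x : ℤ => (x, y)).subset fun p hp => ?_
  simp only [Set.mem_iUnion, Set.mem_Iio]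
  refine ⟨p.2, ?_, p.1, hp, rfl⟩
  by_contra! hlt
  exact absurd ((norm_waveSum_le_integral p.1 p.2).trans_lt (hY _ hlt)) (not_lt.2 hp)

end

/-! ### Boundary values, currents and column relations of the voltage -/

/-- The voltage in the half plane: the real part of the superposition of waves. -/
noncomputable def voltage (x : ℤ) (y : ℕ) : ℝ := (waveSum x y).re

section
open Complex

lemma voltage_of_odd {x : ℤ} {y : ℕ} (h : Odd (x + y)) : voltage x y = 0 :=
  waveSum_re_of_odd h

lemma abs_voltage_le (x : ℤ) (y : ℕ) : |voltage x y| ≤ √2 :=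
  (Complex.abs_re_le_norm _).trans (norm_waveSum_le x y)

/-- The Cauchy-Riemann equations on the four unit squares around (x, y + 1) combine so that the
values of the conjugate cancel. -/
lemma voltage_harmonic (x : ℤ) (y : ℕ) : 4 * voltage x (y + 1) =
    voltage (x + 1) (y + 2) + voltage (x + 1) y + voltage (x - 1) (y + 2) + voltage (x - 1) y := by
  have h1 := waveSum_cauchyRiemann x (y + 1)
  have h2 := waveSum_cauchyRiemann (x - 1) y
  have h3 := waveSum_cauchyRiemann x y
  have h4 := waveSum_cauchyRiemann (x - 1) (y + 1)
  rw [sub_add_cancel] at h2 h4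
  have h : 4 * waveSum x (y + 1) = waveSum (x + 1) (y + 2) + waveSum (x + 1) y +
      waveSum (x - 1) (y + 2) + waveSum (x - 1) y := by
    linear_combination -h1 + h2 + I * h3 - I * h4 + (2 * waveSum x (y + 1) - waveSum (x + 1) y -
      waveSum (x - 1) (y + 2)) * I_sq
  have := congrArg Complex.re h
  simpa [voltage] using this

/-- At the boundary only the two upper squares are available; what fails to cancel is a difference
of conjugate values on the axis. -/
lemma voltage_current (x : ℤ) : 2 * voltage x 0 - voltage (x - 1) 1 - voltage (x + 1) 1 =
    (waveSum (x - 1) 0).im - (waveSum (x + 1) 0).im := by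
  have h1 := waveSum_cauchyRiemann x 0
  have h2 := waveSum_cauchyRiemann (x - 1) 0
  rw [sub_add_cancel] at h2
  rw [zero_add] at h1 h2
  have h : 2 * waveSum x 0 - waveSum (x - 1) 1 - waveSum (x + 1) 1 =
      I * (waveSum (x + 1) 0 - waveSum (x - 1) 0) := by
    linear_combination -h1 - I * h2 + (waveSum x 0 - waveSum (x - 1) 1) * I_sq
  have := congrArg Complex.re h
  simp [voltage] at this ⊢
  linarith

lemma voltage_axis (k : ℕ) : voltage (2 * k) 0 = invSqrtCoeff k := by
  rw [voltage, waveSum_axis_even, ofReal_re]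

lemma voltage_slit (k : ℕ) : voltage (-(2 * (k + 1))) 0 = 0 := by
  rw [voltage, waveSum_axis_neg_even, zero_re]

lemma voltage_axis_neg {x : ℤ} (hx : x < 0) : voltage x 0 = 0 := by
  rcases Int.even_or_odd x with h | h
  · obtain ⟨k, hk⟩ := h
    obtain ⟨m, rfl⟩ : ∃ m : ℕ, k = -(m + 1) := ⟨(-k - 1).toNat, by omega⟩
    rw [hk, ← voltage_slit m]; congr 1; ring
  · exact voltage_of_odd (by simpa using h)

lemma voltage_current_zero : 2 * voltage 0 0 - voltage (-1) 1 - voltage 1 1 = 1 := by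
  have h := voltage_current 0
  have h1 := waveSum_axis_neg_odd 0
  have h2 := waveSum_axis_odd 0
  simp [invSqrtCoeff] at h h1 h2
  rw [h, h1, h2]
  simp

lemma voltage_current_pos {x : ℤ} (hx : 0 < x) :
    2 * voltage x 0 - voltage (x - 1) 1 - voltage (x + 1) 1 = 0 := by
  rw [voltage_current]
  rcases Int.even_or_odd x with ⟨k, hk⟩ | h
  · obtain ⟨m, rfl⟩ : ∃ m : ℕ, k = m + 1 := ⟨(k - 1).toNat, by omega⟩
    have h1 := waveSum_axis_odd m
    have h2 := waveSum_axis_odd (m + 1)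
    rw [show x - 1 = 2 * m + 1 by omega, h1, show x + 1 = 2 * (m + 1 : ℕ) + 1 by omega, h2]
    simp
  · rw [waveSum_im_of_even, waveSum_im_of_even, sub_zero]
    · simpa using h.add_odd odd_one
    · simpa using h.sub_odd odd_one

/-- This is (1 - t) · 1/√(1 - t) = √(1 - t), coefficient by coefficient. -/
lemma invSqrtCoeff_succ_sub (k : ℕ) :
    invSqrtCoeff (k + 1) - invSqrtCoeff k = sqrtCoeff (k + 1) := by
  have h1 : ((k : ℝ) + 1) * (k + 1).centralBinom = 2 * (2 * k + 1) * k.centralBinom := by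
    exact_mod_cast Nat.succ_mul_centralBinom_succ k
  have h2 : (2 * (k : ℝ) + 1) ≠ 0 := by positivity
  have h3 : 2 * ((k : ℝ) + 1) - 1 = 2 * k + 1 := by ring
  simp only [invSqrtCoeff, sqrtCoeff, pow_succ]
  push_cast
  rw [h3]
  field_simp
  linear_combination 2 * h1

lemma voltage_current_neg_even (k : ℕ) : 2 * voltage (-(2 * (k + 1))) 0 -
    voltage (-(2 * (k + 1)) - 1) 1 - voltage (-(2 * (k + 1)) + 1) 1 = sqrtCoeff (k + 1) := by
  have h1 := waveSum_axis_neg_odd (k + 1)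
  have h2 := waveSum_axis_neg_odd k
  push_cast at h1
  rw [voltage_current, h1, show -(2 * ((k : ℤ) + 1)) + 1 = -(2 * k) - 1 by ring, h2,
    ← invSqrtCoeff_succ_sub]
  simp

lemma voltage_current_of_odd {x : ℤ} (h : Odd x) :
    2 * voltage x 0 - voltage (x - 1) 1 - voltage (x + 1) 1 = 0 := by
  rw [voltage_of_odd, voltage_of_odd, voltage_of_odd]
  · simp
  · simpa [add_assoc] using h.add_even (by decide : Even (2 : ℤ))
  · simpa using h
  · simpa using h

lemma voltage_zero_add_two (k : ℕ) :
    voltage 0 (2 * k) + voltage 0 (2 * k + 2) = √2 * voltage (2 * k) 0 := by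
  have h1 := congrArg Complex.re (waveSum_zero_even_sub k)
  have h2 := congrArg Complex.im (waveSum_zero_odd k)
  rw [voltage_axis]
  simp at h1 h2
  simp [voltage]
  linarith

lemma voltage_neg_one (y : ℕ) : voltage (-1) y = voltage 0 (y + 1) := by
  have h := congrArg Complex.re (waveSum_neg_sub_one 0 y)
  simp at h
  rw [voltage, voltage, h]
  rcases Nat.even_or_odd y with ⟨k, rfl⟩ | ⟨k, rfl⟩
  · rw [waveSum_im_of_even (by simp), waveSum_re_of_odd]
    simp
  · simp [waveSum_zero_odd k]

end

section
open Filter Topology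

/-! ### Green's functions that vanish at infinity -/

/-- The mean of a function over the four neighbours of a vertex of `ℤ²`. -/
noncomputable def neighborMean (f : ℤ × ℤ → ℝ) (v : ℤ × ℤ) : ℝ :=
  (f (v.1 + 1, v.2) + f (v.1 - 1, v.2) + f (v.1, v.2 + 1) + f (v.1, v.2 - 1)) / 4

lemma neighborMean_mono {f g : ℤ × ℤ → ℝ} (h : ∀ v, f v ≤ g v) (v : ℤ × ℤ) :
    neighborMean f v ≤ neighborMean g v := by
  unfold neighborMean
  linarith [h (v.1 + 1, v.2), h (v.1 - 1, v.2), h (v.1, v.2 + 1), h (v.1, v.2 - 1)]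

/-- The maximum principle for functions with no positive values at infinity. -/
lemma nonpos_of_subharmonic {B : Set (ℤ × ℤ)} {f : ℤ × ℤ → ℝ}
    (hfin : ∀ ε : ℝ, 0 < ε → {v | ε ≤ f v}.Finite) (hB : ∀ v ∈ B, f v ≤ 0)
    (hsub : ∀ v ∉ B, f v ≤ neighborMean f v) (v : ℤ × ℤ) : f v ≤ 0 := by
  by_contra! hv
  obtain ⟨m, hm, hmax⟩ := Set.exists_max_image _ f (hfin _ hv) ⟨v, le_refl (f v)⟩
  have hmpos : 0 < f m := hv.trans_le hm
  have hle : ∀ w, f w ≤ f m := fun w => by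
    by_cases hw : f v ≤ f w
    · exact hmax w hw
    · exact (not_le.1 hw).le.trans hm
  -- Among the finitely many maximizers take one furthest to the right. The mean inequality makes
  -- its right neighbour a maximizer too, a contradiction.
  obtain ⟨p, hp, hpmax⟩ := Set.exists_max_image _ Prod.fst (hfin _ hmpos) ⟨m, le_refl (f m)⟩
  have hpm : f p = f m := le_antisymm (hle p) hp
  have hpB : p ∉ B := fun h => by linarith [hB p h]
  have h := hsub p hpB
  have hnext : f m ≤ f (p.1 + 1, p.2) := by
    unfold neighborMean at h
    linarith [hle (p.1 - 1, p.2), hle (p.1, p.2 + 1), hle (p.1, p.2 - 1)]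
  have := hpmax (p.1 + 1, p.2) hnext
  simp at this

lemma killedWalk_nonneg (B : Set (ℤ × ℤ)) (u : ℤ × ℤ) (n : ℕ) (v : ℤ × ℤ) :
    0 ≤ killedWalk B u n v := by
  induction n generalizing v with
  | zero => unfold killedWalk; split_ifs <;> norm_num
  | succ n ih =>
    unfold killedWalk
    split_ifs
    · exact le_rfl
    · have h1 := ih (v.1 + 1, v.2)
      have h2 := ih (v.1 - 1, v.2)
      have h3 := ih (v.1, v.2 + 1)
      have h4 := ih (v.1, v.2 - 1)
      positivity

lemma killedWalk_of_mem {B : Set (ℤ × ℤ)} {v : ℤ × ℤ} (hv : v ∈ B) (u : ℤ × ℤ) (n : ℕ) :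
    killedWalk B u n v = 0 := by
  cases n <;> simp [killedWalk, hv]

lemma killedWalk_succ {B : Set (ℤ × ℤ)} {v : ℤ × ℤ} (hv : v ∉ B) (u : ℤ × ℤ) (n : ℕ) :
    killedWalk B u (n + 1) v = neighborMean (killedWalk B u n) v := by
  simp [killedWalk, hv, neighborMean]

lemma killedWalk_zero {B : Set (ℤ × ℤ)} {v : ℤ × ℤ} (hv : v ∉ B) (u : ℤ × ℤ) :
    killedWalk B u 0 v = if v = u then 1 else 0 := by
  simp [killedWalk, hv]

/-- A solution of the Dirichlet problem with unit source that vanishes at infinity is the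
expected number of visits of the killed walk. -/
theorem hasSum_killedWalk {B : Set (ℤ × ℤ)} {u : ℤ × ℤ} {W : ℤ × ℤ → ℝ}
    (hfin : ∀ ε : ℝ, 0 < ε → {v | ε ≤ |W v|}.Finite) (hB : ∀ v ∈ B, W v = 0)
    (hW : ∀ v ∉ B, W v = (if v = u then 1 else 0) + neighborMean W v) (v : ℤ × ℤ) :
    HasSum (fun n => killedWalk B u n v) (W v) := by
  have hWnonneg : ∀ v, 0 ≤ W v := by
    intro v
    have := nonpos_of_subharmonic (B := B) (f := fun v => -W v)
      (fun ε hε => (hfin ε hε).subset fun v hv =>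
        (show ε ≤ -W v from hv).trans (neg_le_abs _))
      (fun v hv => by simp [hB v hv])
      (fun v hv => by
        have h := hW v hv
        have h0 : (0 : ℝ) ≤ if v = u then 1 else 0 := by split_ifs <;> norm_num
        unfold neighborMean at h ⊢
        linarith) v
    linarith
  -- Splitting off time 0 turns the other terms into a neighbour mean of a shorter partial sum, so
  -- the equation for `W` propagates the bound and summability follows.
  have hpartial : ∀ (N : ℕ) (v : ℤ × ℤ), ∑ n ∈ Finset.range N, killedWalk B u n v ≤ W v := by
    intro N
    induction N with
    | zero => simpa using hWnonneg
    | succ N ih =>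
      intro v
      by_cases hv : v ∈ B
      · simp [killedWalk_of_mem hv, hB v hv]
      · rw [Finset.sum_range_succ', killedWalk_zero hv, hW v hv, add_comm]
        simp only [killedWalk_succ hv]
        have h1 : ∑ n ∈ Finset.range N, neighborMean (killedWalk B u n) v =
            neighborMean (fun w => ∑ n ∈ Finset.range N, killedWalk B u n w) v := by
          simp only [neighborMean, ← Finset.sum_div, Finset.sum_add_distrib]
        rw [h1]
        gcongr
        exact neighborMean_mono ih v
  have hsum : ∀ v, Summable fun n => killedWalk B u n v := fun v =>
    summable_of_sum_range_le (fun n => killedWalk_nonneg B u n v) fun N => hpartial N v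
  have hle : ∀ v, ∑' n, killedWalk B u n v ≤ W v := fun v =>
    Real.tsum_le_of_sum_range_le (fun n => killedWalk_nonneg B u n v) fun N => hpartial N v
  have hnonneg : ∀ v, 0 ≤ ∑' n, killedWalk B u n v := fun v =>
    tsum_nonneg fun n => killedWalk_nonneg B u n v
  have hS : ∀ v ∉ B, ∑' n, killedWalk B u n v =
      (if v = u then 1 else 0) + neighborMean (fun w => ∑' n, killedWalk B u n w) v := by
    intro v hv
    rw [(hsum v).tsum_eq_zero_add, killedWalk_zero hv]
    simp only [killedWalk_succ hv, neighborMean]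
    rw [tsum_div_const, Summable.tsum_add, Summable.tsum_add, Summable.tsum_add]
    · exact hsum _
    · exact hsum _
    · exact (hsum _).add (hsum _)
    · exact hsum _
    · exact ((hsum _).add (hsum _)).add (hsum _)
    · exact hsum _
  -- The sources cancel in the difference, which is at most `W`. The maximum principle needs
  -- smallness at infinity only from above, so no decay of the sum is required.
  have h := nonpos_of_subharmonic (B := B) (f := fun v => W v - ∑' n, killedWalk B u n v)
    (fun ε hε => (hfin ε hε).subset fun v hv => by
      have h1 : ε ≤ W v - ∑' n, killedWalk B u n v := hv
      have h2 := hnonneg v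
      exact (by linarith : ε ≤ W v).trans (le_abs_self _))
    (fun v hv => by
      have := hnonneg v
      simp only [hB v hv]; linarith)
    (fun v hv => by
      have h1 := hW v hv
      have h2 := hS v hv
      unfold neighborMean at h1 h2 ⊢
      linarith) v
  rw [le_antisymm (b := ∑' n, killedWalk B u n v) (by linarith) (hle v)]
  exact (hsum v).hasSum

/-! ### The Green's function of the slit plane -/

/-- Twice the voltage, in the coordinates of the square lattice. -/
noncomputable def latticeVoltage (v : ℤ × ℤ) : ℝ := 2 * voltage (v.1 + v.2) (v.2 - v.1).natAbs

lemma finite_le_abs_latticeVoltage {ε : ℝ} (hε : 0 < ε) :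
    {v | ε ≤ |latticeVoltage v|}.Finite := by
  have h := finite_le_norm_waveSum (half_pos hε)
  refine Set.Finite.subset ((h.image fun p : ℤ × ℕ => ((p.1 - p.2) / 2, (p.1 + p.2) / 2)).union
    (h.image fun p : ℤ × ℕ => ((p.1 + p.2) / 2, (p.1 - p.2) / 2))) fun v hv => ?_
  have hmem : (v.1 + v.2, (v.2 - v.1).natAbs) ∈ {p : ℤ × ℕ | ε / 2 ≤ ‖waveSum p.1 p.2‖} := by
    have h1 : ε ≤ |2 * (waveSum (v.1 + v.2) (v.2 - v.1).natAbs).re| := hv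
    have h2 := Complex.abs_re_le_norm (waveSum (v.1 + v.2) (v.2 - v.1).natAbs)
    rw [abs_mul, abs_two] at h1
    change ε / 2 ≤ ‖waveSum (v.1 + v.2) (v.2 - v.1).natAbs‖
    linarith
  rcases le_total v.1 v.2 with h | h
  · refine Or.inl ⟨_, hmem, ?_⟩
    apply Prod.ext <;> simp only <;> omega
  · refine Or.inr ⟨_, hmem, ?_⟩
    apply Prod.ext <;> simp only <;> omega

lemma latticeVoltage_of_mem_slit {v : ℤ × ℤ} (hv : v ∈ slit) : latticeVoltage v = 0 := by
  obtain ⟨k, hk, rfl⟩ := hv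
  simp [latticeVoltage, voltage_axis_neg (show k + k < 0 by omega)]

lemma latticeVoltage_swap (a b : ℤ) : latticeVoltage (a, b) = latticeVoltage (b, a) := by
  simp only [latticeVoltage]
  rw [add_comm, ← Int.natAbs_neg, neg_sub]

lemma latticeVoltage_add (a : ℤ) (m : ℕ) :
    latticeVoltage (a, a + m) = 2 * voltage (2 * a + m) m := by
  simp only [latticeVoltage]
  congr 2 <;> omega

lemma latticeVoltage_poisson_above (a : ℤ) (m : ℕ) :
    latticeVoltage (a, a + (m + 1)) = neighborMean latticeVoltage (a, a + (m + 1)) := by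
  have h0 := latticeVoltage_add a (m + 1)
  have h1 := latticeVoltage_add (a + 1) m
  have h2 := latticeVoltage_add (a - 1) (m + 2)
  have h3 := latticeVoltage_add a (m + 2)
  have h4 := latticeVoltage_add a m
  have h := voltage_harmonic (2 * a + (m + 1)) m
  push_cast at h0 h1 h2 h3 h4
  rw [show a + 1 + (m : ℤ) = a + (m + 1) by ring,
    show 2 * (a + 1) + (m : ℤ) = 2 * a + (m + 1) + 1 by ring] at h1
  rw [show a - 1 + (m + 2 : ℤ) = a + (m + 1) by ring,
    show 2 * (a - 1) + (m + 2 : ℤ) = 2 * a + (m + 1) - 1 by ring] at h2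
  rw [show a + (m + 2 : ℤ) = a + (m + 1) + 1 by ring,
    show 2 * a + (m + 2 : ℤ) = 2 * a + (m + 1) + 1 by ring] at h3
  rw [show a + (m : ℤ) = a + (m + 1) - 1 by ring,
    show 2 * a + (m : ℤ) = 2 * a + (m + 1) - 1 by ring] at h4
  simp only [neighborMean]
  rw [h0, h1, h2, h3, h4]
  linarith

/-- By symmetry the four neighbours give two values, each taken twice. With the factor 2 in
`latticeVoltage`, the value minus its neighbour mean is exactly the boundary current at 2a. -/
lemma latticeVoltage_poisson_diag {a : ℤ} (ha : 0 ≤ a) : latticeVoltage (a, a) =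
    (if ((a, a) : ℤ × ℤ) = (0, 0) then 1 else 0) + neighborMean latticeVoltage (a, a) := by
  have h0 := latticeVoltage_add a 0
  have h1 := latticeVoltage_add a 1
  have h2 := latticeVoltage_add (a - 1) 1
  have h3 := latticeVoltage_swap (a + 1) a
  have h4 := latticeVoltage_swap a (a - 1)
  push_cast at h0 h1 h2
  rw [add_zero, add_zero] at h0
  rw [sub_add_cancel, show 2 * (a - 1) + 1 = 2 * a - 1 by ring] at h2
  simp only [neighborMean]
  rw [h3, h4, h0, h1, h2]
  rcases ha.eq_or_lt with rfl | hpos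
  · have := voltage_current_zero
    simp
    linarith
  · have := voltage_current_pos (show 0 < 2 * a by omega)
    rw [if_neg (by simp; omega)]
    linarith

lemma neighborMean_latticeVoltage_swap (a b : ℤ) :
    neighborMean latticeVoltage (a, b) = neighborMean latticeVoltage (b, a) := by
  simp only [neighborMean]
  rw [latticeVoltage_swap (a + 1), latticeVoltage_swap (a - 1), latticeVoltage_swap a,
    latticeVoltage_swap a]
  ring

lemma latticeVoltage_poisson {v : ℤ × ℤ} (hv : v ∉ slit) : latticeVoltage v =
    (if v = (0, 0) then 1 else 0) + neighborMean latticeVoltage v := by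
  obtain ⟨a, b⟩ := v
  rcases lt_trichotomy a b with h | rfl | h
  · obtain ⟨m, rfl⟩ : ∃ m : ℕ, b = a + (m + 1) := ⟨(b - a - 1).toNat, by omega⟩
    rw [if_neg (by simp; omega), zero_add]
    exact latticeVoltage_poisson_above a m
  · refine latticeVoltage_poisson_diag ?_
    by_contra! hneg
    exact hv ⟨a, by omega, rfl⟩
  · obtain ⟨m, rfl⟩ : ∃ m : ℕ, a = b + (m + 1) := ⟨(a - b - 1).toNat, by omega⟩
    rw [if_neg (by simp; omega), zero_add, latticeVoltage_swap, neighborMean_latticeVoltage_swap]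
    exact latticeVoltage_poisson_above b m

lemma hasSum_killedWalk_slit (v : ℤ × ℤ) :
    HasSum (fun n => killedWalk slit (0, 0) n v) (latticeVoltage v) :=
  hasSum_killedWalk (fun _ hε => finite_le_abs_latticeVoltage hε)
    (fun _ hv => latticeVoltage_of_mem_slit hv) (fun _ hv => latticeVoltage_poisson hv) v

lemma GH_eq_voltage (x y : ℤ) : GH x y = voltage x y.natAbs := by
  unfold GH
  split_ifs with h
  · rw [dirichletGreen, (hasSum_killedWalk_slit _).tsum_eq, latticeVoltage]
    obtain ⟨k, hk⟩ := h
    have h1 : (x - y) / 2 + (x + y) / 2 = x := by omega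
    have h2 : (x + y) / 2 - (x - y) / 2 = y := by omega
    rw [h1, h2]
    ring
  · refine (voltage_of_odd ?_).symm
    rcases Int.natAbs_eq y with hy | hy <;> rw [Int.not_even_iff_odd] at h <;> grind

lemma GH_natCast (x : ℤ) (y : ℕ) : GH x y = voltage x y := by
  rw [GH_eq_voltage, Int.natAbs_natCast]

lemma GH_axis (x : ℤ) : GH x 0 = voltage x 0 := GH_natCast x 0

lemma GH_one (x : ℤ) : GH x 1 = voltage x 1 := GH_natCast x 1

lemma boundaryCurrent_eq (x : ℤ) : boundaryCurrent x =
    2 * voltage x 0 - voltage (x - 1) 1 - voltage (x + 1) 1 := by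
  rw [boundaryCurrent, GH_axis, GH_one, GH_one]

lemma GH_harmonic (x y : ℤ) (hy : 1 ≤ y) : 4 * GH x y =
    GH (x + 1) (y + 1) + GH (x + 1) (y - 1) + GH (x - 1) (y + 1) + GH (x - 1) (y - 1) := by
  obtain ⟨m, rfl⟩ : ∃ m : ℕ, y = m + 1 := ⟨(y - 1).toNat, by omega⟩
  have e1 : (m : ℤ) + 1 + 1 = (m + 2 : ℕ) := by push_cast; ring
  have e2 : (m : ℤ) + 1 = (m + 1 : ℕ) := by push_cast; ring
  have e3 : (m : ℤ) + 1 - 1 = (m : ℕ) := by ring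
  rw [e1, e3, e2]
  simp only [GH_natCast]
  exact voltage_harmonic x m

end

section
open Complex

/-! ### The boundary generating functions -/

lemma choose_neg_half (n : ℕ) :
    Ring.choose (-(1 / 2) : ℂ) n = (-1) ^ n * (invSqrtCoeff n : ℂ) := by
  induction n with
  | zero => simp [invSqrtCoeff]
  | succ n ih =>
    have h1 := Ring.descPochhammer_eq_factorial_smul_choose (-(1 / 2) : ℂ) n
    have h2 := Ring.descPochhammer_eq_factorial_smul_choose (-(1 / 2) : ℂ) (n + 1)
    rw [descPochhammer_succ_right, Polynomial.smeval_mul, h1, ih, Nat.factorial_succ] at h2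
    simp only [Polynomial.smeval_sub, Polynomial.smeval_X, Polynomial.smeval_natCast,
      nsmul_eq_mul, pow_one, pow_zero, mul_one, Nat.cast_mul, Nat.cast_add, Nat.cast_one] at h2
    have h3 : ((n : ℂ) + 1) * (n + 1).centralBinom = 2 * (2 * n + 1) * n.centralBinom := by
      exact_mod_cast Nat.succ_mul_centralBinom_succ n
    have h4 : (n.factorial : ℂ) ≠ 0 := by exact_mod_cast n.factorial_ne_zero
    have h5 : (n : ℂ) + 1 ≠ 0 := by norm_cast
    apply mul_left_cancel₀ (mul_ne_zero h5 h4)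
    rw [← h2]
    simp only [invSqrtCoeff, pow_succ]
    push_cast
    field_simp
    linear_combination 2 * h3

lemma hasSum_invSqrtCoeff {s : ℂ} (hs : ‖s‖ < 1) :
    HasSum (fun k : ℕ => (invSqrtCoeff k : ℂ) * s ^ k) (1 / Complex.sqrt (1 - s)) := by
  have h := (one_add_cpow_hasFPowerSeriesOnBall_zero (a := -(1 / 2))).hasSum
    (y := -s) (by simpa [enorm_eq_nnnorm, ← NNReal.coe_lt_one] using hs)
  have e : (1 + (0 + -s)) ^ (-(1 / 2) : ℂ) = 1 / Complex.sqrt (1 - s) := by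
    rw [zero_add, ← sub_eq_add_neg, cpow_neg, Complex.sqrt, one_div, one_div]
  rw [e] at h
  refine h.congr_fun fun k => ?_
  rw [binomialSeries_apply, choose_neg_half]
  simp only [List.ofFn_const, List.prod_replicate, smul_eq_mul, neg_pow s]
  have : (-1 : ℂ) ^ k * (-1) ^ k = 1 := by
    rw [← pow_add]; exact Even.neg_one_pow ⟨k, rfl⟩
  linear_combination ((-(invSqrtCoeff k : ℂ)) * s ^ k) * this

lemma complex_sqrt_mul_self (s : ℂ) : Complex.sqrt s * Complex.sqrt s = s := by
  rw [← sq, Complex.sqrt]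
  exact cpow_nat_inv_pow s two_ne_zero

lemma hasSum_sqrtCoeff {s : ℂ} (hs : ‖s‖ < 1) :
    HasSum (fun k : ℕ => (sqrtCoeff k : ℂ) * s ^ k) (Complex.sqrt (1 - s)) := by
  have h := hasSum_invSqrtCoeff hs
  have h1 := ((hasSum_nat_add_iff' 1).2 h).sub (h.mul_left s)
  have h2 : HasSum (fun k : ℕ => (sqrtCoeff (k + 1) : ℂ) * s ^ (k + 1)) _ :=
    h1.congr_fun fun k => by
      rw [← invSqrtCoeff_succ_sub]; push_cast; ring
  have h3 := (hasSum_nat_add_iff (f := fun k : ℕ => (sqrtCoeff k : ℂ) * s ^ k) 1).1 h2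
  have hne : Complex.sqrt (1 - s) ≠ 0 := by
    intro h0
    have := complex_sqrt_mul_self (1 - s)
    rw [h0, mul_zero, eq_comm, sub_eq_zero] at this
    rw [← this] at hs
    simp at hs
  have := complex_sqrt_mul_self (1 - s)
  refine (congrArg (HasSum _ · _) ?_).mp h3
  simp only [Finset.sum_range_one, sqrtCoeff, invSqrtCoeff, Nat.centralBinom_zero, pow_zero]
  push_cast
  field_simp
  linear_combination this

lemma hasSum_even_of {f : ℕ → ℂ} {a : ℂ} (hodd : ∀ k, f (2 * k + 1) = 0)
    (h : HasSum (fun k => f (2 * k)) a) : HasSum f a := by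
  refine ((mul_right_injective₀ (two_ne_zero (α := ℕ))).hasSum_iff fun n hn => ?_).1 h
  rcases Nat.even_or_odd' n with ⟨k, rfl | rfl⟩
  · exact absurd ⟨k, rfl⟩ hn
  · exact hodd k

lemma norm_sq_lt_one {z : ℂ} (hz : ‖z‖ < 1) : ‖z ^ 2‖ < 1 := by
  rw [norm_pow]
  exact pow_lt_one₀ (norm_nonneg z) hz two_ne_zero

lemma hasSum_voltage_axis {z : ℂ} (hz : ‖z‖ < 1) :
    HasSum (fun k : ℕ => (voltage k 0 : ℂ) * z ^ k) (1 / Complex.sqrt (1 - z ^ 2)) := by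
  refine hasSum_even_of (fun k => ?_) ?_
  · rw [voltage_of_odd (by simp), ofReal_zero, zero_mul]
  · refine (hasSum_invSqrtCoeff (norm_sq_lt_one hz)).congr_fun fun k => ?_
    push_cast
    rw [voltage_axis, pow_mul]

lemma boundaryCurrent_of_odd {x : ℤ} (hx : Odd x) : boundaryCurrent x = 0 := by
  rw [boundaryCurrent_eq, voltage_current_of_odd hx]

lemma boundaryCurrent_zero : boundaryCurrent 0 = 1 := by
  have := voltage_current_zero
  rw [boundaryCurrent_eq]
  simpa using this

lemma boundaryCurrent_pos {x : ℤ} (hx : 0 < x) : boundaryCurrent x = 0 := by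
  rw [boundaryCurrent_eq, voltage_current_pos hx]

lemma boundaryCurrent_neg_even (k : ℕ) : boundaryCurrent (-(2 * k)) = sqrtCoeff k := by
  cases k with
  | zero => simp [boundaryCurrent_zero, sqrtCoeff]
  | succ k =>
    have := voltage_current_neg_even k
    rw [boundaryCurrent_eq]
    push_cast
    exact this

lemma hasSum_boundaryCurrent {z : ℂ} (hz : ‖z‖ < 1) :
    HasSum (fun k : ℕ => (boundaryCurrent (-(k : ℤ)) : ℂ) * z ^ k)
      (Complex.sqrt (1 - z ^ 2)) := by
  refine hasSum_even_of (fun k => ?_) ?_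
  · rw [boundaryCurrent_of_odd (by simp; grind), ofReal_zero, zero_mul]
  · refine (hasSum_sqrtCoeff (norm_sq_lt_one hz)).congr_fun fun k => ?_
    push_cast
    rw [boundaryCurrent_neg_even, pow_mul]

/-! ### Generating functions over a quadrant -/

lemma hasSum_shift_left {g : ℤ → ℂ} {z R : ℂ} (h : HasSum (fun m : ℕ => g m * z ^ m) R) :
    HasSum (fun m : ℕ => g (m + 1) * z ^ (m + 1)) (R - g 0) := by
  simpa using (hasSum_nat_add_iff' 1).2 h

lemma hasSum_shift_right {g : ℤ → ℂ} {z R : ℂ} (h : HasSum (fun m : ℕ => g m * z ^ m) R) :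
    HasSum (fun m : ℕ => g (m - 1) * z ^ (m + 1)) (z * g (-1) + z ^ 2 * R) := by
  have h1 : HasSum (fun m : ℕ => g ((m + 1 : ℕ) - 1) * z ^ (m + 1 + 1)) (z ^ 2 * R) :=
    (h.mul_left (z ^ 2)).congr_fun fun m => by
      push_cast
      rw [add_sub_cancel_right]; ring
  have h2 := (hasSum_nat_add_iff (f := fun m : ℕ => g (m - 1) * z ^ (m + 1)) 1).1 h1
  simpa [add_comm, mul_comm] using h2

lemma summable_quadrant {f : ℤ → ℕ → ℝ} {M : ℝ} (hM : ∀ x y, |f x y| ≤ M) {z w : ℂ}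
    (hz : ‖z‖ < 1) (hw : ‖w‖ < 1) :
    Summable fun p : ℕ × ℕ => (f p.1 p.2 : ℂ) * z ^ p.1 * w ^ p.2 := by
  have h := ((summable_geometric_of_lt_one (norm_nonneg z) hz).mul_of_nonneg
    (summable_geometric_of_lt_one (norm_nonneg w) hw) (fun _ => by positivity)
    (fun _ => by positivity)).mul_left M
  refine Summable.of_norm_bounded h fun p => ?_
  rw [norm_mul, norm_mul, norm_pow, norm_pow, norm_real, Real.norm_eq_abs, mul_assoc]
  gcongr
  exact hM _ _

lemma hasSum_rows {f : ℤ → ℕ → ℝ} {z w : ℂ} {R : ℕ → ℂ} {S : ℂ}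
    (hR : ∀ y, HasSum (fun m : ℕ => (f m y : ℂ) * z ^ m) (R y))
    (hS : HasSum (fun p : ℕ × ℕ => (f p.1 p.2 : ℂ) * z ^ p.1 * w ^ p.2) S) :
    HasSum (fun y => R y * w ^ y) S := by
  have h := (Equiv.prodComm ℕ ℕ).hasSum_iff.2 hS
  exact h.prod_fiberwise fun y => (hR y).mul_right (w ^ y)

/-- The functional equation for the quadrant generating function of a bounded function that is
harmonic off the axis. -/
theorem quadrant_functional_equation {f : ℤ → ℕ → ℝ} {M : ℝ} (hM : ∀ x y, |f x y| ≤ M)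
    (hf : ∀ x y, 4 * f x (y + 1) =
      f (x + 1) (y + 2) + f (x + 1) y + f (x - 1) (y + 2) + f (x - 1) y)
    {z w : ℂ} (hz : ‖z‖ < 1) {a : ℕ → ℂ} {p q E V R₀ S : ℂ}
    (hcol : ∀ y, z * (f (-1) (y + 2) + f (-1) y) - (f 0 (y + 2) + f 0 y) =
      p * a y + q * a (y + 1))
    (hcur : HasSum (fun m : ℕ =>
      ((2 * f m 0 - f (m - 1) 1 - f (m + 1) 1 : ℝ) : ℂ) * z ^ (m + 1)) E)
    (ha : a 0 = 1) (hV : HasSum (fun y => a y * w ^ y) V)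
    (hR₀ : HasSum (fun m : ℕ => (f m 0 : ℂ) * z ^ m) R₀)
    (hS : HasSum (fun p : ℕ × ℕ => (f p.1 p.2 : ℂ) * z ^ p.1 * w ^ p.2) S) :
    (4 * z * w - (1 + z ^ 2) * (1 + w ^ 2)) * S = (2 * z * w - 1 - z ^ 2) * R₀ +
      (p * w ^ 2 + q * w) * V + (E + z * f (-1) 1 - f 0 1 - q) * w := by
  have hRsum : ∀ y, Summable fun m : ℕ => (f m y : ℂ) * z ^ m := fun y => by
    refine Summable.of_norm_bounded ((summable_geometric_of_lt_one (norm_nonneg z) hz).mul_left M)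
      fun m => ?_
    rw [norm_mul, norm_pow, norm_real, Real.norm_eq_abs]
    gcongr
    exact hM _ _
  obtain ⟨R, hR⟩ : ∃ R : ℕ → ℂ, ∀ y, HasSum (fun m : ℕ => (f m y : ℂ) * z ^ m) (R y) :=
    ⟨_, fun y => (hRsum y).hasSum⟩
  have hR0 : R 0 = R₀ := (hR 0).unique hR₀
  have hl : ∀ y, HasSum (fun m : ℕ => (f (m + 1) y : ℂ) * z ^ (m + 1)) (R y - f 0 y) :=
    fun y => hasSum_shift_left (g := fun x => (f x y : ℂ)) (hR y)
  have hr : ∀ y, HasSum (fun m : ℕ => (f (m - 1) y : ℂ) * z ^ (m + 1))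
      (z * f (-1) y + z ^ 2 * R y) :=
    fun y => hasSum_shift_right (g := fun x => (f x y : ℂ)) (hR y)
  -- Harmonicity along row y + 1, weighted by z^(m+1). The shifts leave terms from columns -1 and 0
  -- only, which `hcol` evaluates.
  have hrow : ∀ y, 4 * z * R (y + 1) =
      (1 + z ^ 2) * (R (y + 2) + R y) + p * a y + q * a (y + 1) := fun y => by
    have h1 := (hR (y + 1)).mul_left (4 * z)
    have h2 := (((hl (y + 2)).add (hl y)).add (hr (y + 2))).add (hr y)
    have h3 := h1.unique (h2.congr_fun fun m => by
      have : (4 : ℂ) * f m (y + 1) = f (m + 1) (y + 2) + f (m + 1) y + f (m - 1) (y + 2) +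
          f (m - 1) y := by exact_mod_cast hf m y
      linear_combination z ^ (m + 1) * this)
    linear_combination h3 + hcol y
  -- On the bottom row the current equation replaces harmonicity.
  have hrow0 : 2 * z * R 0 = E + (1 + z ^ 2) * R 1 + z * f (-1) 1 - f 0 1 := by
    have h1 := (hR 0).mul_left (2 * z)
    have h2 := (hcur.add (hl 1)).add (hr 1)
    have h3 := h1.unique (h2.congr_fun fun m => by push_cast; ring)
    linear_combination h3
  have hSR := hasSum_rows hR hS
  have hS1 := ((hasSum_nat_add_iff' 1).2 hSR).mul_left (4 * z * w)
  have hS2 := (((hasSum_nat_add_iff' 2).2 hSR).add (hSR.mul_left (w ^ 2))).mul_left (1 + z ^ 2)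
  have hV1 := ((hasSum_nat_add_iff' 1).2 hV).mul_left (q * w)
  have key := hS1.unique (((hS2.add (hV.mul_left (p * w ^ 2))).add hV1).congr_fun fun y => by
    linear_combination w ^ (y + 2) * hrow y)
  simp only [Finset.sum_range_succ, Finset.sum_range_zero, pow_zero, pow_one, ha, zero_add,
    mul_one] at key
  rw [← hR0]
  linear_combination key + w * hrow0

end

/-! ### Evaluation of the two quadrant generating functions -/

section
open Complex

lemma voltage_zero_zero : voltage 0 0 = 1 := by
  rw [voltage, waveSum_zero_zero, one_re]

lemma voltage_neg_one_one : voltage (-1) 1 = √2 - 1 := by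
  have h := voltage_zero_add_two 0
  rw [voltage_neg_one]
  simp only [mul_zero, Nat.cast_zero, voltage_zero_zero, zero_add] at h
  norm_num
  linarith

lemma voltage_zero_one : voltage 0 1 = 0 := voltage_of_odd (by simp)

lemma voltage_column_relation (y : ℕ) :
    voltage 0 y + voltage 0 (y + 2) = √2 * voltage y 0 := by
  rcases Nat.even_or_odd' y with ⟨k, rfl | rfl⟩
  · have := voltage_zero_add_two k
    push_cast
    exact this
  · rw [voltage_of_odd (by simp), voltage_of_odd (by simp), voltage_of_odd (by simp)]
    simp

lemma first_quadrant {z w S : ℂ} (hz : ‖z‖ < 1) (hw : ‖w‖ < 1)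
    (hS : HasSum (fun p : ℕ × ℕ => (voltage p.1 p.2 : ℂ) * z ^ p.1 * w ^ p.2) S) :
    (4 * z * w - w ^ 2 - z ^ 2 - z ^ 2 * w ^ 2 - 1) * S =
      (√2 : ℂ) * (z * w - w ^ 2) / Complex.sqrt (1 - w ^ 2) +
        (2 * z * w - z ^ 2 - 1) / Complex.sqrt (1 - z ^ 2) := by
  have hcur : HasSum (fun m : ℕ => ((2 * voltage m 0 - voltage (m - 1) 1 - voltage (m + 1) 1 : ℝ)
      : ℂ) * z ^ (m + 1)) z := by
    have h := hasSum_ite_eq (0 : ℕ) z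
    refine h.congr_fun fun m => ?_
    rcases Nat.eq_zero_or_pos m with rfl | hm
    · have := voltage_current_zero
      simp only [Nat.cast_zero, zero_sub, zero_add, this]
      simp
    · rw [voltage_current_pos (by omega), if_neg hm.ne']
      simp
  have h := quadrant_functional_equation abs_voltage_le voltage_harmonic hz
    -- Column -1 is column 0 shifted by one, so both column sums are √2 times axis values, at
    -- indices y + 1 and y.
    (a := fun y => (voltage y 0 : ℂ)) (p := -√2) (q := √2 * z)
    (fun y => by
      have h1 : (voltage 0 y : ℂ) + voltage 0 (y + 2) = √2 * voltage y 0 := by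
        exact_mod_cast voltage_column_relation y
      have h2 : (voltage 0 (y + 1) : ℂ) + voltage 0 (y + 3) = √2 * voltage (y + 1) 0 := by
        exact_mod_cast voltage_column_relation (y + 1)
      rw [voltage_neg_one, voltage_neg_one]
      push_cast
      linear_combination z * h2 - h1)
    hcur (by simp [voltage_zero_zero]) (hasSum_voltage_axis hw) (hasSum_voltage_axis hz) hS
  rw [voltage_neg_one_one, voltage_zero_one] at h
  push_cast at h
  linear_combination h

lemma second_quadrant {z w S : ℂ} (hz : ‖z‖ < 1) (hw : ‖w‖ < 1)
    (hS : HasSum (fun p : ℕ × ℕ => (voltage (-1 - p.1) p.2 : ℂ) * z ^ p.1 * w ^ p.2) S) :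
    (4 * z * w - (1 + z ^ 2) * (1 + w ^ 2)) * S =
      √2 * (z * w ^ 2 - w) / Complex.sqrt (1 - w ^ 2) + w * Complex.sqrt (1 - z ^ 2) := by
  have hcur : HasSum (fun m : ℕ => ((2 * voltage (-1 - m) 0 - voltage (-1 - (m - 1)) 1 -
      voltage (-1 - (m + 1)) 1 : ℝ) : ℂ) * z ^ (m + 1)) (Complex.sqrt (1 - z ^ 2) - 1) := by
    have h := (hasSum_nat_add_iff' 1).2 (hasSum_boundaryCurrent hz)
    simp only [Finset.sum_range_one, Nat.cast_zero, neg_zero, boundaryCurrent_zero, pow_zero,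
      mul_one, ofReal_one] at h
    refine h.congr_fun fun m => ?_
    rw [boundaryCurrent_eq]
    push_cast
    rw [show -1 - (m : ℤ) = -(m + 1) by ring, show -1 - ((m : ℤ) - 1) = -(m + 1) + 1 by ring,
      show -1 - ((m : ℤ) + 1) = -(m + 1) - 1 by ring]
    ring
  have h := quadrant_functional_equation (f := fun x y => voltage (-1 - x) y)
    (fun x y => abs_voltage_le _ y)
    (fun x y => by
      have := voltage_harmonic (-1 - x) y
      rw [show -1 - (x + 1) = -1 - x - 1 by ring, show -1 - (x - 1) = -1 - x + 1 by ring]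
      linarith) hz
    -- The reflection x ↦ -1 - x exchanges columns 0 and -1, and with them the roles of `p` and `q`.
    -- The bottom row vanishes, being the slit.
    (a := fun y => (voltage y 0 : ℂ)) (p := √2 * z) (q := -√2) (R₀ := 0)
    (fun y => by
      have h1 : (voltage 0 y : ℂ) + voltage 0 (y + 2) = √2 * voltage y 0 := by
        exact_mod_cast voltage_column_relation y
      have h2 : (voltage 0 (y + 1) : ℂ) + voltage 0 (y + 3) = √2 * voltage (y + 1) 0 := by
        exact_mod_cast voltage_column_relation (y + 1)
      simp only [sub_neg_eq_add, neg_add_cancel, sub_zero, voltage_neg_one]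
      push_cast
      linear_combination z * h1 - h2)
    hcur (by simp [voltage_zero_zero]) (hasSum_voltage_axis hw)
    ((hasSum_zero).congr_fun fun m => by
      rw [voltage_axis_neg (by omega), ofReal_zero, zero_mul]) hS
  simp only [sub_neg_eq_add, neg_add_cancel, sub_zero, voltage_neg_one_one,
    voltage_zero_one] at h
  push_cast at h
  linear_combination h

lemma GH_first_quadrant {z w : ℂ} (hz : ‖z‖ < 1) (hw : ‖w‖ < 1) : ∃ S : ℂ,
    HasSum (fun p : ℕ × ℕ => (GH (p.1 : ℤ) (p.2 : ℤ) : ℂ) * z ^ p.1 * w ^ p.2) S ∧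
    (4 * z * w - w ^ 2 - z ^ 2 - z ^ 2 * w ^ 2 - 1) * S =
      (√2 : ℂ) * (z * w - w ^ 2) / Complex.sqrt (1 - w ^ 2) +
        (2 * z * w - z ^ 2 - 1) / Complex.sqrt (1 - z ^ 2) ∧
    (z ≠ 0 → w ≠ 0 → 4 - w / z - z / w - z * w - 1 / (z * w) ≠ 0 →
      S = ((√2 : ℂ) * (1 - w / z) / Complex.sqrt (1 - w ^ 2) +
          (2 - z / w - 1 / (z * w)) / Complex.sqrt (1 - z ^ 2)) /
        (4 - w / z - z / w - z * w - 1 / (z * w))) := by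
  obtain ⟨S, hS⟩ := summable_quadrant abs_voltage_le hz hw
  refine ⟨S, by simpa only [GH_natCast] using hS, first_quadrant hz hw hS, fun hz0 hw0 hK => ?_⟩
  rw [eq_div_iff hK]
  have h := first_quadrant hz hw hS
  apply mul_left_cancel₀ (mul_ne_zero hz0 hw0)
  calc _ = (4 * z * w - w ^ 2 - z ^ 2 - z ^ 2 * w ^ 2 - 1) * S := by field_simp
    _ = _ := h
    _ = _ := by
      generalize Complex.sqrt (1 - w ^ 2) = a
      generalize Complex.sqrt (1 - z ^ 2) = b
      simp only [div_eq_mul_inv _ a, div_eq_mul_inv _ b]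
      generalize a⁻¹ = a
      generalize b⁻¹ = b
      field_simp

lemma GH_second_quadrant {z w : ℂ} (hz : 1 < ‖z‖) (hw : ‖w‖ < 1) : ∃ S : ℂ,
    HasSum (fun p : ℕ × ℕ =>
      (GH (-((p.1 : ℤ) + 1)) (p.2 : ℤ) : ℂ) * z ^ (-((p.1 : ℤ) + 1)) * w ^ p.2) S ∧
    (4 * z * w - w ^ 2 - z ^ 2 - z ^ 2 * w ^ 2 - 1) * S =
      (√2 : ℂ) * (w ^ 2 - z * w) / Complex.sqrt (1 - w ^ 2) +
        z * w * Complex.sqrt (1 - 1 / z ^ 2) ∧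
    (w ≠ 0 → 4 - w / z - z / w - z * w - 1 / (z * w) ≠ 0 →
      S = ((√2 : ℂ) * (w / z - 1) / Complex.sqrt (1 - w ^ 2) +
          Complex.sqrt (1 - 1 / z ^ 2)) /
        (4 - w / z - z / w - z * w - 1 / (z * w))) := by
  have hz0 : z ≠ 0 := norm_pos_iff.1 (one_pos.trans hz)
  have hzi : ‖z⁻¹‖ < 1 := by
    rw [norm_inv]; exact inv_lt_one_of_one_lt₀ hz
  -- The reflected series is taken at z⁻¹; since its index starts at x = -1, one more factor z⁻¹
  -- gives the wanted sum.
  obtain ⟨T, hT⟩ := summable_quadrant (f := fun x y => voltage (-1 - x) y)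
    (fun x y => abs_voltage_le _ y) hzi hw
  have h := second_quadrant hzi hw hT
  have hkey : (4 * z * w - w ^ 2 - z ^ 2 - z ^ 2 * w ^ 2 - 1) * (z⁻¹ * T) =
      (√2 : ℂ) * (w ^ 2 - z * w) / Complex.sqrt (1 - w ^ 2) +
        z * w * Complex.sqrt (1 - 1 / z ^ 2) := by
    rw [show (1 : ℂ) / z ^ 2 = z⁻¹ ^ 2 by rw [one_div, inv_pow]]
    have h' := congrArg (fun t => z * t) h
    generalize Complex.sqrt (1 - z⁻¹ ^ 2) = b at h' ⊢
    generalize Complex.sqrt (1 - w ^ 2) = a at h' ⊢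
    simp only [div_eq_mul_inv _ a] at h' ⊢
    generalize a⁻¹ = a at h' ⊢
    have e : z * z⁻¹ = 1 := mul_inv_cancel₀ hz0
    generalize z⁻¹ = v at *
    grind
  refine ⟨z⁻¹ * T, ?_, hkey, fun hw0 hK => ?_⟩
  · refine (hT.mul_left z⁻¹).congr_fun fun p => ?_
    rw [GH_natCast, show -((p.1 : ℤ) + 1) = -1 - p.1 by ring]
    rw [show (-1 - (p.1 : ℤ)) = -((p.1 + 1 : ℕ) : ℤ) by push_cast; ring, zpow_neg, zpow_natCast,
      pow_succ, inv_pow]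
    field_simp
  · rw [eq_div_iff hK]
    apply mul_left_cancel₀ (mul_ne_zero hz0 hw0)
    calc _ = (4 * z * w - w ^ 2 - z ^ 2 - z ^ 2 * w ^ 2 - 1) * (z⁻¹ * T) := by
          generalize z⁻¹ * T = S
          field_simp
      _ = _ := hkey
      _ = _ := by
        generalize Complex.sqrt (1 - w ^ 2) = a
        generalize Complex.sqrt (1 - 1 / z ^ 2) = b
        simp only [div_eq_mul_inv _ a]
        generalize a⁻¹ = a
        field_simp

lemma hasSum_boundaryCurrent_zpow {z : ℂ} (hz : 1 < ‖z‖) :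
    HasSum (fun k : ℕ => (boundaryCurrent (-(k : ℤ)) : ℂ) * z ^ (-(k : ℤ)))
      (Complex.sqrt (1 - 1 / z ^ 2)) := by
  have hzi : ‖z⁻¹‖ < 1 := by
    rw [norm_inv]; exact inv_lt_one_of_one_lt₀ hz
  have h := hasSum_boundaryCurrent hzi
  simpa [inv_pow] using h

lemma hasSum_GH_axis {z : ℂ} (hz : ‖z‖ < 1) :
    HasSum (fun k : ℕ => (GH (2 * (k : ℤ)) 0 : ℂ) * z ^ (2 * k))
      (1 / Complex.sqrt (1 - z ^ 2)) := by
  refine (hasSum_invSqrtCoeff (norm_sq_lt_one hz)).congr_fun fun k => ?_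
  rw [GH_axis, voltage_axis, pow_mul]

end

lemma GH_zero_add_two (k : ℕ) :
    GH 0 (2 * (k : ℤ)) + GH 0 (2 * (k : ℤ) + 2) = √2 * GH (2 * (k : ℤ)) 0 := by
  have e1 : (2 * (k : ℤ)) = ((2 * k : ℕ) : ℤ) := by push_cast; ring
  have e2 : (2 * (k : ℤ) + 2) = ((2 * k + 2 : ℕ) : ℤ) := by push_cast; ring
  rw [GH_axis, e2, e1, GH_natCast, GH_natCast]
  have := voltage_zero_add_two k
  push_cast
  exact this

lemma GH_column_shift (y : ℤ) (hy : 0 < y) : GH 0 y = GH (-1) (y - 1) := by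
  obtain ⟨m, rfl⟩ : ∃ m : ℕ, y = m + 1 := ⟨(y - 1).toNat, by omega⟩
  have e : ((m : ℤ) + 1) = ((m + 1 : ℕ) : ℤ) := by push_cast; ring
  rw [add_sub_cancel_right, e, GH_natCast, GH_natCast, voltage_neg_one]

/-! ### The algorithm -/

lemma halfPlaneAlg_sound {x y : ℤ} {a : ℝ} (h : HalfPlaneAlg x y a) : a = GH x y := by
  induction h with
  | axis k => rw [GH_axis, voltage_axis]
  | slit k => rw [GH_axis, voltage_slit]
  | vertical k a b _ _ iha ihb =>
    have := GH_zero_add_two k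
    rw [iha, ihb]; linarith
  | offVertical y a hy _ ih => rw [ih, GH_column_shift y hy]
  | boundaryRight x a b hx _ _ iha ihb =>
    have hc : boundaryCurrent x = if x = 0 then 1 else 0 := by
      split_ifs with h
      · rw [h, boundaryCurrent_zero]
      · exact boundaryCurrent_pos (lt_of_le_of_ne hx (Ne.symm h))
    rw [iha, ihb, ← hc, boundaryCurrent]; ring
  | boundaryLeft k a b _ _ _ iha ihb =>
    rw [iha, ihb, ← boundaryCurrent_neg_even, boundaryCurrent]; ring
  | interiorRight x y a b c d hy _ _ _ _ iha ihb ihc ihd =>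
    have := GH_harmonic x y hy
    rw [iha, ihb, ihc, ihd]; linarith
  | interiorLeft x y a b c d hy _ _ _ _ iha ihb ihc ihd =>
    have := GH_harmonic x y hy
    rw [iha, ihb, ihc, ihd]; linarith

/-- The algorithm produces some value at the vertex `(x, y)`. -/
def AlgReaches (x y : ℤ) : Prop := ∃ a, HalfPlaneAlg x y a

lemma algReaches_column_zero (k : ℕ) : AlgReaches 0 (2 * k) := by
  induction k with
  | zero => exact ⟨_, by simpa using HalfPlaneAlg.axis 0⟩
  | succ k ih =>
    obtain ⟨a, ha⟩ := ih
    have := HalfPlaneAlg.vertical k a _ ha (HalfPlaneAlg.axis k)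
    rw [show (2 * (k : ℤ)) + 2 = 2 * ((k + 1 : ℕ) : ℤ) by push_cast; ring] at this
    exact ⟨_, this⟩

lemma algReaches_column_neg_one (k : ℕ) : AlgReaches (-1) (2 * k + 1) := by
  obtain ⟨a, ha⟩ := algReaches_column_zero (k + 1)
  have := HalfPlaneAlg.offVertical _ a (by positivity) ha
  exact ⟨a, by rwa [show (2 * ((k + 1 : ℕ) : ℤ)) - 1 = 2 * k + 1 by push_cast; ring] at this⟩

lemma algReaches_axis {x : ℤ} (hx : Even x) : AlgReaches x 0 := by
  obtain ⟨k, rfl⟩ := hx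
  rcases le_or_gt 0 k with hk | hk
  · lift k to ℕ using hk
    exact ⟨_, by simpa [two_mul] using HalfPlaneAlg.axis k⟩
  · obtain ⟨m, rfl⟩ : ∃ m : ℕ, k = -(m + 1) := ⟨(-k - 1).toNat, by omega⟩
    rw [show -((m : ℤ) + 1) + -(m + 1) = -(2 * (m + 1)) by ring]
    exact ⟨_, HalfPlaneAlg.slit m⟩

/-- Columns are filled from left to right and each from the bottom up: the equation centred in
column n yields the entry of column n + 1 above its last known one. Column -1 starts the sweep
together with column 0. -/
lemma algReaches_right (n : ℕ) : ∀ m : ℕ, Even ((n : ℤ) + m) →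
    AlgReaches n m := by
  induction n using Nat.strong_induction_on with
  | _ n ihn =>
    intro m
    induction m using Nat.strong_induction_on with
    | _ m ihm =>
      intro h
      match n, m with
      | 0, m =>
        obtain ⟨k, rfl⟩ : ∃ k : ℕ, m = 2 * k := ⟨m / 2, by grind⟩
        simpa using algReaches_column_zero k
      | n + 1, 0 => exact algReaches_axis (by simpa using h)
      | n + 1, m + 1 =>
        have hprev : ∀ m : ℕ, Even ((n : ℤ) - 1 + m) → AlgReaches (n - 1) m := by
          intro m hm
          match n with
          | 0 =>
            obtain ⟨k, rfl⟩ : ∃ k : ℕ, m = 2 * k + 1 := ⟨m / 2, by grind⟩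
            simpa using algReaches_column_neg_one k
          | n + 1 =>
            have := ihn n (by omega) m (by simpa using hm)
            simpa using this
        obtain ⟨a, ha⟩ := ihn n (by omega) m (by grind)
        push_cast
        match m with
        | 0 =>
          obtain ⟨b, hb⟩ := hprev 1 (by grind)
          exact ⟨_, HalfPlaneAlg.boundaryRight n a b (by positivity) (by simpa using ha)
            (by simpa using hb)⟩
        | m + 1 =>
          obtain ⟨b, hb⟩ := hprev m (by grind)
          obtain ⟨c, hc⟩ := hprev (m + 2) (by grind)
          obtain ⟨d, hd⟩ := ihm m (by omega) (by grind)
          push_cast at *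
          refine ⟨_, HalfPlaneAlg.interiorRight n (m + 1) a b c d (by omega) ha ?_ ?_ ?_⟩
          · simpa using hb
          · simpa [add_assoc] using hc
          · simpa using hd

lemma algReaches_left (n : ℕ) : ∀ m : ℕ, Even ((n : ℤ) + m) →
    AlgReaches (-n) m := by
  induction n using Nat.strong_induction_on with
  | _ n ihn =>
    intro m
    induction m using Nat.strong_induction_on with
    | _ m ihm =>
      intro h
      match n, m with
      | 0, m =>
        simpa using algReaches_right 0 m h
      | 1, m =>
        obtain ⟨k, rfl⟩ : ∃ k : ℕ, m = 2 * k + 1 := ⟨m / 2, by grind⟩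
        simpa using algReaches_column_neg_one k
      | n + 2, 0 => exact algReaches_axis (by grind)
      | n + 2, m + 1 =>
        obtain ⟨a, ha⟩ := ihn (n + 1) (by omega) m (by grind)
        push_cast at *
        match m with
        | 0 =>
          obtain ⟨b, hb⟩ := ihn n (by omega) 1 (by grind)
          obtain ⟨k, rfl⟩ : ∃ k : ℕ, n = 2 * k + 1 := ⟨n / 2, by grind⟩
          have := HalfPlaneAlg.boundaryLeft (k + 1) a b (by omega)
            (by convert ha using 1 <;> push_cast <;> ring)
            (by convert hb using 1 <;> push_cast <;> ring)
          rw [show -(2 * ((k + 1 : ℕ) : ℤ)) - 1 = -(((2 * k + 1 : ℕ) : ℤ) + 2) by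
            push_cast; ring] at this
          exact ⟨_, this⟩
        | m + 1 =>
          obtain ⟨b, hb⟩ := ihn n (by omega) m (by grind)
          obtain ⟨c, hc⟩ := ihn n (by omega) (m + 2) (by grind)
          obtain ⟨d, hd⟩ := ihm m (by omega) (by grind)
          push_cast at *
          have := HalfPlaneAlg.interiorLeft (-(n + 1)) (m + 1) a b c d (by omega) ha
            (by convert hb using 1 <;> ring) (by convert hc using 1 <;> ring)
            (by convert hd using 1 <;> ring)
          rw [show -((n : ℤ) + 1) - 1 = -(n + 2) by ring] at this
          exact ⟨_, this⟩

/-- Soundness determines any value produced, so it suffices that some value is reached. -/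
theorem halfPlaneAlg_iff {x y : ℤ} (hy : 0 ≤ y) (h : Even (x + y)) (a : ℝ) :
    HalfPlaneAlg x y a ↔ a = GH x y := by
  refine ⟨halfPlaneAlg_sound, ?_⟩
  rintro rfl
  have hr : AlgReaches x y := by
    lift y to ℕ using hy
    rcases le_or_gt 0 x with hx | hx
    · lift x to ℕ using hx
      exact algReaches_right x y h
    · obtain ⟨n, rfl⟩ : ∃ n : ℕ, x = -n := ⟨(-x).toNat, by omega⟩
      exact algReaches_left n y (by grind)
  obtain ⟨b, hb⟩ := hr
  rwa [← halfPlaneAlg_sound hb]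

section
open Encodable

/-! ### Primitive recursive integer arithmetic -/

lemma encode_int_ofNat (n : ℕ) : encode (n : ℤ) = 2 * n := rfl

lemma encode_int_negSucc (n : ℕ) : encode (Int.negSucc n) = 2 * n + 1 := rfl

lemma primrec_toNat : Primrec Int.toNat := by
  have h : Primrec fun z : ℤ => if encode z % 2 = 0 then encode z / 2 else 0 :=
    Primrec.ite (Primrec.eq.comp (Primrec.nat_mod.comp Primrec.encode (Primrec.const 2))
      (Primrec.const 0)) (Primrec.nat_div.comp Primrec.encode (Primrec.const 2)) (Primrec.const 0)
  refine h.of_eq fun z => ?_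
  cases z with
  | ofNat n => rw [Int.ofNat_eq_natCast, encode_int_ofNat]; simp
  | negSucc n => rw [encode_int_negSucc, if_neg (by omega)]; simp

lemma primrec_neg_toNat : Primrec fun z : ℤ => (-z).toNat := by
  have h : Primrec fun z : ℤ => if encode z % 2 = 0 then 0 else encode z / 2 + 1 :=
    Primrec.ite (Primrec.eq.comp (Primrec.nat_mod.comp Primrec.encode (Primrec.const 2))
      (Primrec.const 0)) (Primrec.const 0)
      (Primrec.succ.comp (Primrec.nat_div.comp Primrec.encode (Primrec.const 2)))
  refine h.of_eq fun z => ?_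
  cases z with
  | ofNat n => rw [Int.ofNat_eq_natCast, encode_int_ofNat, if_pos (by omega)]; omega
  | negSucc n => rw [encode_int_negSucc, if_neg (by omega)]; omega

lemma primrec_natCast_sub : Primrec₂ fun m n : ℕ => (m : ℤ) - n := by
  refine Primrec.encode_iff.1 ?_
  have h : Primrec fun p : ℕ × ℕ =>
      if p.2 ≤ p.1 then 2 * (p.1 - p.2) else 2 * (p.2 - p.1 - 1) + 1 :=
    Primrec.ite (Primrec.nat_le.comp Primrec.snd Primrec.fst)
      (Primrec.nat_mul.comp (Primrec.const 2) (Primrec.nat_sub.comp Primrec.fst Primrec.snd))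
      (Primrec.succ.comp (Primrec.nat_mul.comp (Primrec.const 2)
        (Primrec.nat_sub.comp (Primrec.nat_sub.comp Primrec.snd Primrec.fst) (Primrec.const 1))))
  refine h.of_eq fun p => ?_
  obtain ⟨m, n⟩ := p
  simp only
  split_ifs with hmn
  · rw [← encode_int_ofNat]; congr 1; omega
  · rw [← encode_int_negSucc]; congr 1; omega

/-- Splitting into positive and negative parts reduces integer arithmetic to natural numbers and one
final difference. -/
lemma primrec_int_add : Primrec₂ fun a b : ℤ => a + b := by
  have h : Primrec fun p : ℤ × ℤ =>
      ((p.1.toNat + p.2.toNat : ℕ) : ℤ) - ((-p.1).toNat + (-p.2).toNat : ℕ) :=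
    primrec_natCast_sub.comp
      (Primrec.nat_add.comp (primrec_toNat.comp Primrec.fst) (primrec_toNat.comp Primrec.snd))
      (Primrec.nat_add.comp (primrec_neg_toNat.comp Primrec.fst)
        (primrec_neg_toNat.comp Primrec.snd))
  exact h.of_eq fun p => by dsimp only; omega

lemma primrec_int_sub : Primrec₂ fun a b : ℤ => a - b := by
  have h : Primrec fun p : ℤ × ℤ =>
      ((p.1.toNat + (-p.2).toNat : ℕ) : ℤ) - ((-p.1).toNat + p.2.toNat : ℕ) :=
    primrec_natCast_sub.comp
      (Primrec.nat_add.comp (primrec_toNat.comp Primrec.fst) (primrec_neg_toNat.comp Primrec.snd))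
      (Primrec.nat_add.comp (primrec_neg_toNat.comp Primrec.fst)
        (primrec_toNat.comp Primrec.snd))
  exact h.of_eq fun p => by dsimp only; omega

lemma primrec_int_two_mul : Primrec fun a : ℤ => 2 * a :=
  (primrec_int_add.comp Primrec.id Primrec.id).of_eq fun a => by simp [two_mul]

lemma primrec_natCast : Primrec fun n : ℕ => (n : ℤ) :=
  (primrec_natCast_sub.comp Primrec.id (Primrec.const 0)).of_eq fun n => by simp

lemma primrec_centralBinom : Primrec Nat.centralBinom := by
  have h : Primrec fun n : ℕ => (Nat.rec 1 (fun k c => 2 * (2 * k + 1) * c / (k + 1)) n : ℕ) :=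
    Primrec.nat_rec₁ 1 (Primrec.nat_div.comp
      (Primrec.nat_mul.comp (Primrec.nat_mul.comp (Primrec.const 2) (Primrec.succ.comp
        (Primrec.nat_mul.comp (Primrec.const 2) Primrec.fst))) Primrec.snd)
      (Primrec.succ.comp Primrec.fst))
  refine h.of_eq fun n => ?_
  induction n with
  | zero => simp
  | succ n ih =>
    simp only at ih ⊢
    rw [ih, ← Nat.succ_mul_centralBinom_succ, Nat.mul_div_cancel_left _ n.succ_pos]

/-! ### The discrete Cauchy-Riemann table -/

/-- The table with first row `r` and first column `r 0, c 0, c 1, …` that satisfies the rescaled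
discrete Cauchy-Riemann recurrence. -/
def crTable (r c : ℕ → ℤ) : ℕ → ℕ → ℤ
  | x, 0 => r x
  | 0, y + 1 => c y
  | x + 1, y + 1 =>
    if (x + y) % 2 = 0 then
      2 * (2 * crTable r c x y) + 2 * (crTable r c (x + 1) y - crTable r c x (y + 1))
    else 2 * (2 * crTable r c x y) - 2 * (crTable r c (x + 1) y - crTable r c x (y + 1))
termination_by x y => x + y

/-- The entry of a table of integers, listed along the pairing function. -/
def listEntry (l : List ℤ) (x y : ℕ) : ℤ := (l[Nat.pair x y]?).getD 0

lemma primrec_listEntry {α : Type*} [Primcodable α] {l : α → List ℤ} {x y : α → ℕ}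
    (hl : Primrec l) (hx : Primrec x) (hy : Primrec y) :
    Primrec fun a => listEntry (l a) (x a) (y a) :=
  Primrec.option_getD.comp (Primrec.list_getElem?.comp hl (Primrec₂.natPair.comp hx hy))
    (Primrec.const 0)

lemma listEntry_map_range (f : ℕ → ℕ → ℤ) {n x y : ℕ} (h : Nat.pair x y < n) :
    listEntry ((List.range n).map fun i => f i.unpair.1 i.unpair.2) x y = f x y := by
  simp [listEntry, h]

lemma primrec_crTable {r c : ℕ → ℤ} (hr : Primrec r) (hc : Primrec c) :
    Primrec₂ (crTable r c) := by
  have hx : Primrec fun l : List ℤ => l.length.unpair.1 :=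
    Primrec.fst.comp (Primrec.unpair.comp Primrec.list_length)
  have hy : Primrec fun l : List ℤ => l.length.unpair.2 :=
    Primrec.snd.comp (Primrec.unpair.comp Primrec.list_length)
  have hx' := Primrec.pred.comp hx
  have hy' := Primrec.pred.comp hy
  have h0 := primrec_int_two_mul.comp (primrec_int_two_mul.comp
    (primrec_listEntry Primrec.id hx' hy'))
  have h1 := primrec_int_two_mul.comp (primrec_int_sub.comp (primrec_listEntry Primrec.id hx hy')
    (primrec_listEntry Primrec.id hx' hy))
  have hstep := Primrec.ite (Primrec.eq.comp (Primrec.nat_mod.comp (Primrec.nat_add.comp hx' hy')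
    (Primrec.const 2)) (Primrec.const 0)) (primrec_int_add.comp h0 h1) (primrec_int_sub.comp h0 h1)
  have hG := Primrec.option_some.comp (Primrec.ite (Primrec.eq.comp hy (Primrec.const 0))
    (hr.comp hx) (Primrec.ite (Primrec.eq.comp hx (Primrec.const 0)) (hc.comp hy') hstep))
  -- Course-of-values recursion along the pairing function. Pairing is strictly increasing in each
  -- argument, so the three entries needed are already listed; the length of the list encodes the
  -- current position.
  have hrec := Primrec.nat_strong_rec
    (fun (_ : Unit) n => crTable r c n.unpair.1 n.unpair.2) (hG.comp₂ Primrec₂.right)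
    (fun _ n => by
      obtain ⟨⟨x, y⟩, rfl⟩ : ∃ p : ℕ × ℕ, Nat.pair p.1 p.2 = n := ⟨n.unpair, Nat.pair_unpair n⟩
      simp only [List.length_map, List.length_range, Nat.unpair_pair, id]
      congr 1
      match x, y with
      | x, 0 => simp [crTable]
      | 0, y + 1 => simp [crTable]
      | x + 1, y + 1 =>
        have e1 : Nat.pair x y < Nat.pair (x + 1) (y + 1) :=
          (Nat.pair_lt_pair_left _ x.lt_succ_self).trans (Nat.pair_lt_pair_right _ y.lt_succ_self)
        rw [if_neg (Nat.succ_ne_zero y), if_neg (Nat.succ_ne_zero x)]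
        simp only [Nat.pred_succ]
        rw [listEntry_map_range _ e1,
          listEntry_map_range _ (Nat.pair_lt_pair_right _ y.lt_succ_self),
          listEntry_map_range _ (Nat.pair_lt_pair_left _ x.lt_succ_self)]
        rw [crTable])
  have := hrec.comp (Primrec.const ()) (Primrec₂.natPair.comp (Primrec.fst (α := ℕ) (β := ℕ))
    Primrec.snd)
  exact this.of_eq fun p => by simp

/-- The even entries of the first column of the table with column sources `e`. -/
def evenColumn (e : ℕ → ℤ) (i : ℤ) : ℕ → ℤ
  | 0 => i
  | k + 1 => 2 * (2 * (e k - evenColumn e i k))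

/-- The entries of the first column, after the corner. -/
def tableColumn (e : ℕ → ℤ) (i : ℤ) (y : ℕ) : ℤ :=
  if y % 2 = 0 then 2 * (e (y / 2) - evenColumn e i (y / 2)) else evenColumn e i (y / 2 + 1)

lemma primrec_evenColumn {e : ℕ → ℤ} (he : Primrec e) (i : ℤ) : Primrec (evenColumn e i) := by
  have h : Primrec fun n : ℕ => (Nat.rec i (fun k c => 2 * (2 * (e k - c))) n : ℤ) :=
    Primrec.nat_rec₁ i (primrec_int_two_mul.comp (primrec_int_two_mul.comp
      (primrec_int_sub.comp (he.comp Primrec.fst) Primrec.snd)))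
  refine h.of_eq fun n => ?_
  induction n with
  | zero => rfl
  | succ n ih =>
    simp only at ih ⊢
    rw [ih, evenColumn]

lemma primrec_tableColumn {e : ℕ → ℤ} (he : Primrec e) (i : ℤ) : Primrec (tableColumn e i) := by
  have hd : Primrec fun y : ℕ => y / 2 := Primrec.nat_div.comp Primrec.id (Primrec.const 2)
  exact Primrec.ite (Primrec.eq.comp (Primrec.nat_mod.comp Primrec.id (Primrec.const 2))
    (Primrec.const 0))
    (primrec_int_two_mul.comp (primrec_int_sub.comp (he.comp hd)
      ((primrec_evenColumn he i).comp hd)))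
    ((primrec_evenColumn he i).comp (Primrec.succ.comp hd))

/-- The first row of the table of the rational parts. -/
def tableRow (x : ℕ) : ℤ := if x % 2 = 0 then ((x / 2).centralBinom : ℤ) else 0

lemma primrec_tableRow : Primrec tableRow :=
  Primrec.ite (Primrec.eq.comp (Primrec.nat_mod.comp Primrec.id (Primrec.const 2))
    (Primrec.const 0))
    (primrec_natCast.comp (primrec_centralBinom.comp
      (Primrec.nat_div.comp Primrec.id (Primrec.const 2)))) (Primrec.const 0)

/-- The numerators of the rational parts of the voltages and their conjugates. -/
def ratTable : ℕ → ℕ → ℤ := crTable tableRow (tableColumn (fun _ => 0) 1)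

/-- The numerators of the coefficients of `√2` in the voltages and their conjugates. -/
def sqrtTable : ℕ → ℕ → ℤ :=
  crTable (fun _ => 0) (tableColumn (fun k => (k.centralBinom : ℤ)) 0)

lemma primrec_ratTable : Primrec₂ ratTable :=
  primrec_crTable primrec_tableRow (primrec_tableColumn (Primrec.const 0) 1)

lemma primrec_sqrtTable : Primrec₂ sqrtTable :=
  primrec_crTable (Primrec.const 0)
    (primrec_tableColumn (primrec_natCast.comp primrec_centralBinom) 0)

end

/-! ### Exact values from the integer tables -/

section
open Complex

/-- The voltage at the points with `x + y` even, its harmonic conjugate at the other points. -/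
noncomputable def conjPair (x y : ℕ) : ℝ := (waveSum x y).re + (waveSum x y).im

lemma conjPair_of_even {x y : ℕ} (h : (x + y) % 2 = 0) : conjPair x y = (waveSum x y).re := by
  rw [conjPair, waveSum_im_of_even, add_zero]
  exact_mod_cast Nat.even_iff.2 h

lemma conjPair_of_odd {x y : ℕ} (h : (x + y) % 2 ≠ 0) : conjPair x y = (waveSum x y).im := by
  rw [conjPair, waveSum_re_of_odd, zero_add]
  exact_mod_cast Nat.odd_iff.2 (by omega)

lemma conjPair_succ_of_even {x y : ℕ} (h : (x + y) % 2 = 0) : conjPair (x + 1) (y + 1) =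
    conjPair x y + (conjPair (x + 1) y - conjPair x (y + 1)) := by
  have := congrArg Complex.re (waveSum_cauchyRiemann x y)
  rw [conjPair_of_even h, conjPair_of_even (by omega), conjPair_of_odd (by omega),
    conjPair_of_odd (by omega)]
  simp at this ⊢
  linarith

lemma conjPair_succ_of_odd {x y : ℕ} (h : (x + y) % 2 ≠ 0) : conjPair (x + 1) (y + 1) =
    conjPair x y - (conjPair (x + 1) y - conjPair x (y + 1)) := by
  have := congrArg Complex.im (waveSum_cauchyRiemann x y)
  rw [conjPair_of_odd h, conjPair_of_odd (by omega), conjPair_of_even (by omega),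
    conjPair_of_even (by omega)]
  simp at this ⊢
  linarith

lemma conjPair_axis_even (k : ℕ) : conjPair (2 * k) 0 = invSqrtCoeff k := by
  have := waveSum_axis_even k
  simp [conjPair, this]

lemma conjPair_axis_odd (k : ℕ) : conjPair (2 * k + 1) 0 = 0 := by
  have := waveSum_axis_odd k
  simp [conjPair, this]

lemma conjPair_column_even (k : ℕ) :
    conjPair 0 (2 * k) + conjPair 0 (2 * k + 1) = √2 * invSqrtCoeff k := by
  have := congrArg Complex.re (waveSum_zero_even_sub k)
  rw [conjPair_of_even (by omega), conjPair_of_odd (by omega)]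
  simp at this ⊢
  linarith

lemma conjPair_column_odd (k : ℕ) : conjPair 0 (2 * k + 1) = conjPair 0 (2 * k + 2) := by
  have := congrArg Complex.im (waveSum_zero_odd k)
  rw [conjPair_of_odd (by omega), conjPair_of_even (by omega)]
  simpa using this

lemma two_pow_two_mul_mul_invSqrtCoeff (k : ℕ) :
    2 ^ (2 * k) * invSqrtCoeff k = k.centralBinom := by
  rw [invSqrtCoeff, pow_mul]
  norm_num
  field_simp

lemma two_pow_mul_conjPair_column_even (k : ℕ) : 2 ^ (2 * k) * conjPair 0 (2 * k) =
    (evenColumn (fun _ => 0) 1 k : ℝ) + evenColumn (fun k => (k.centralBinom : ℤ)) 0 k * √2 := by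
  induction k with
  | zero =>
    have := conjPair_axis_even 0
    simp [evenColumn, invSqrtCoeff] at this ⊢
    exact this
  | succ k ih =>
    have h1 := conjPair_column_even k
    have h2 := conjPair_column_odd k
    have h3 := two_pow_two_mul_mul_invSqrtCoeff k
    have h4 : conjPair 0 (2 * (k + 1)) = √2 * invSqrtCoeff k - conjPair 0 (2 * k) := by
      rw [show 2 * (k + 1) = 2 * k + 2 by ring]; linarith
    rw [h4]
    simp only [evenColumn]
    push_cast
    rw [show (2 : ℝ) ^ (2 * (k + 1)) = 4 * 2 ^ (2 * k) by ring]
    linear_combination 4 * √2 * h3 - 4 * ih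

/-- The power 2^(x+y) clears the denominators 4^k of the axis values and is compatible with the
Cauchy-Riemann step. The first row is rational; √2 enters through the first column alone. -/
lemma two_pow_mul_conjPair (x y : ℕ) : 2 ^ (x + y) * conjPair x y =
    (ratTable x y : ℝ) + sqrtTable x y * √2 := by
  induction h : x + y using Nat.strong_induction_on generalizing x y with
  | _ n ih =>
    subst h
    match x, y with
    | x, 0 =>
      simp only [ratTable, sqrtTable, crTable, tableRow]
      rcases Nat.even_or_odd' x with ⟨k, rfl | rfl⟩
      · rw [conjPair_axis_even, if_pos (by omega), Nat.mul_div_cancel_left _ two_pos, add_zero,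
          two_pow_two_mul_mul_invSqrtCoeff]
        simp
      · rw [conjPair_axis_odd, if_neg (by omega)]
        simp
    | 0, y + 1 =>
      simp only [ratTable, sqrtTable, crTable, tableColumn]
      rcases Nat.even_or_odd' y with ⟨k, rfl | rfl⟩
      · have h1 := conjPair_column_even k
        have h3 := two_pow_two_mul_mul_invSqrtCoeff k
        have h4 := two_pow_mul_conjPair_column_even k
        rw [if_pos (by omega), if_pos (by omega), Nat.mul_div_cancel_left _ two_pos, zero_add,
          pow_succ]
        push_cast
        linear_combination 2 * 2 ^ (2 * k) * h1 + 2 * √2 * h3 - 2 * h4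
      · have h4 := two_pow_mul_conjPair_column_even (k + 1)
        rw [if_neg (by omega), if_neg (by omega), show (2 * k + 1) / 2 = k by omega, ← h4]
        congr 2
        omega
    | x + 1, y + 1 =>
      have h1 := ih (x + y) (by omega) x y rfl
      have h2 := ih (x + 1 + y) (by omega) (x + 1) y rfl
      have h3 := ih (x + (y + 1)) (by omega) x (y + 1) rfl
      rw [show x + 1 + y = x + y + 1 by ring, pow_succ] at h2
      rw [show x + (y + 1) = x + y + 1 by ring, pow_succ] at h3
      rw [show x + 1 + (y + 1) = x + y + 1 + 1 by ring, pow_succ, pow_succ]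
      simp only [ratTable, sqrtTable] at h1 h2 h3 ⊢
      rw [crTable, crTable]
      split_ifs with hp
      · rw [conjPair_succ_of_even hp]
        push_cast
        linear_combination 4 * h1 + 2 * h2 - 2 * h3
      · rw [conjPair_succ_of_odd hp]
        push_cast
        linear_combination 4 * h1 - 2 * h2 + 2 * h3

lemma voltage_of_nonneg {x y : ℕ} (h : (x + y) % 2 = 0) : voltage x y = conjPair x y := by
  rw [conjPair_of_even h, voltage]

/-- By reflection, the voltage on the left is the harmonic conjugate on the right, so one table over
x ≥ 0 serves both halves. -/
lemma voltage_of_neg {x y : ℕ} (h : (x + y) % 2 ≠ 0) : voltage (-x - 1) y = conjPair x y := by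
  rw [conjPair_of_odd h, voltage, waveSum_neg_sub_one]
  simp

/-- The numerators and the exponent of the denominator of the voltage at a vertex. -/
def exactValue (p : ℤ × ℕ) : ℤ × ℤ × ℕ :=
  -- The parity test uses |x|. By truncated subtraction the column index below is x for x ≥ 0 and -x
  -- - 1 for x < 0.
  if (p.1.toNat + (-p.1).toNat + p.2) % 2 = 0 then
    (ratTable (p.1.toNat + ((-p.1).toNat - 1)) p.2,
      sqrtTable (p.1.toNat + ((-p.1).toNat - 1)) p.2, p.1.toNat + ((-p.1).toNat - 1) + p.2)
  else (0, 0, 0)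

lemma primrec_exactValue : Primrec exactValue := by
  have hp : Primrec fun p : ℤ × ℕ => p.1.toNat := primrec_toNat.comp Primrec.fst
  have hn : Primrec fun p : ℤ × ℕ => (-p.1).toNat := primrec_neg_toNat.comp Primrec.fst
  have hm : Primrec fun p : ℤ × ℕ => p.1.toNat + ((-p.1).toNat - 1) :=
    Primrec.nat_add.comp hp (Primrec.pred.comp hn)
  exact Primrec.ite (Primrec.eq.comp (Primrec.nat_mod.comp
      (Primrec.nat_add.comp (Primrec.nat_add.comp hp hn) Primrec.snd) (Primrec.const 2))
      (Primrec.const 0))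
    (Primrec.pair (primrec_ratTable.comp hm Primrec.snd)
      (Primrec.pair (primrec_sqrtTable.comp hm Primrec.snd)
        (Primrec.nat_add.comp hm Primrec.snd)))
    (Primrec.const (0, 0, 0))

lemma GH_eq_exactValue (x : ℤ) (y : ℕ) : GH x y =
    (((exactValue (x, y)).1 : ℝ) + ((exactValue (x, y)).2.1 : ℝ) * √2) /
      2 ^ (exactValue (x, y)).2.2 := by
  rw [GH_natCast]
  unfold exactValue
  simp only
  split_ifs with h
  · rw [eq_div_iff (by positivity), mul_comm, ← two_pow_mul_conjPair]
    congr 1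
    rcases le_or_gt 0 x with hx | hx
    · lift x to ℕ using hx
      rw [show (-(x : ℤ)).toNat = 0 by omega] at h ⊢
      simp only [Int.toNat_natCast, add_zero, Nat.zero_sub] at h ⊢
      exact voltage_of_nonneg h
    · obtain ⟨m, rfl⟩ : ∃ m : ℕ, x = -m - 1 := ⟨(-x - 1).toNat, by omega⟩
      rw [show (-(m : ℤ) - 1).toNat + ((-(-(m : ℤ) - 1)).toNat - 1) = m by omega]
      exact voltage_of_neg (by omega)
  · rw [voltage_of_odd]
    · simp
    · rw [Int.odd_iff]; omega

lemma GH_mem_adjoin (x y : ℤ) (hy : 0 ≤ y) :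
    GH x y ∈ Algebra.adjoin ℤ ({1 / 2, √2} : Set ℝ) := by
  lift y to ℕ using hy
  have h1 : (2⁻¹ : ℝ) ∈ Algebra.adjoin ℤ ({1 / 2, √2} : Set ℝ) :=
    Algebra.subset_adjoin (Or.inl (one_div 2).symm)
  have h2 : √2 ∈ Algebra.adjoin ℤ ({1 / 2, √2} : Set ℝ) :=
    Algebra.subset_adjoin (by simp)
  rw [GH_eq_exactValue, div_eq_mul_inv (_ + _), ← inv_pow]
  exact mul_mem (add_mem (intCast_mem _ _) (mul_mem (intCast_mem _ _) h2)) (pow_mem h1 _)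

end

theorem mainTheorem3 :
    -- the Green's function is well defined (the expected times are finite)
    (∀ v : ℤ × ℤ, Summable (fun n : ℕ => killedWalk slit (0, 0) n v)) ∧
    -- boundary conditions and harmonicity in the half plane
    (∀ x : ℤ, x < 0 → GH x 0 = 0) ∧
    boundaryCurrent 0 = 1 ∧
    (∀ x : ℤ, 0 < x → boundaryCurrent x = 0) ∧
    (∀ x y : ℤ, 1 ≤ y → 4 * GH x y =
      GH (x + 1) (y + 1) + GH (x + 1) (y - 1) + GH (x - 1) (y + 1) + GH (x - 1) (y - 1)) ∧
    -- boundary generating functions `C` and `V`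
    (∀ z : ℂ, 1 < ‖z‖ →
      HasSum (fun k : ℕ => (boundaryCurrent (-(k : ℤ)) : ℂ) * z ^ (-(k : ℤ)))
        (Complex.sqrt (1 - 1 / z ^ 2))) ∧
    (∀ z : ℂ, ‖z‖ < 1 →
      HasSum (fun k : ℕ => (GH (2 * (k : ℤ)) 0 : ℂ) * z ^ (2 * k))
        (1 / Complex.sqrt (1 - z ^ 2))) ∧
    -- vertical recurrence, and the relation between the columns `0` and `-1`
    (∀ k : ℕ, GH 0 (2 * (k : ℤ)) + GH 0 (2 * (k : ℤ) + 2) = √2 * GH (2 * (k : ℤ)) 0) ∧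
    (∀ y : ℤ, 0 < y → GH 0 y = GH (-1) (y - 1)) ∧
    -- generating function of the first quadrant, first with denominators cleared
    (∀ z w : ℂ, ‖z‖ < 1 → ‖w‖ < 1 → ∃ S : ℂ,
      HasSum (fun p : ℕ × ℕ => (GH (p.1 : ℤ) (p.2 : ℤ) : ℂ) * z ^ p.1 * w ^ p.2) S ∧
      (4 * z * w - w ^ 2 - z ^ 2 - z ^ 2 * w ^ 2 - 1) * S =
        (√2 : ℂ) * (z * w - w ^ 2) / Complex.sqrt (1 - w ^ 2) +
          (2 * z * w - z ^ 2 - 1) / Complex.sqrt (1 - z ^ 2) ∧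
      (z ≠ 0 → w ≠ 0 → 4 - w / z - z / w - z * w - 1 / (z * w) ≠ 0 →
        S = ((√2 : ℂ) * (1 - w / z) / Complex.sqrt (1 - w ^ 2) +
            (2 - z / w - 1 / (z * w)) / Complex.sqrt (1 - z ^ 2)) /
          (4 - w / z - z / w - z * w - 1 / (z * w)))) ∧
    -- generating function of the second quadrant (`x = -(m + 1) < 0`)
    (∀ z w : ℂ, 1 < ‖z‖ → ‖w‖ < 1 → ∃ S : ℂ,
      HasSum (fun p : ℕ × ℕ =>
        (GH (-((p.1 : ℤ) + 1)) (p.2 : ℤ) : ℂ) * z ^ (-((p.1 : ℤ) + 1)) * w ^ p.2) S ∧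
      (4 * z * w - w ^ 2 - z ^ 2 - z ^ 2 * w ^ 2 - 1) * S =
        (√2 : ℂ) * (w ^ 2 - z * w) / Complex.sqrt (1 - w ^ 2) +
          z * w * Complex.sqrt (1 - 1 / z ^ 2) ∧
      (w ≠ 0 → 4 - w / z - z / w - z * w - 1 / (z * w) ≠ 0 →
        S = ((√2 : ℂ) * (w / z - 1) / Complex.sqrt (1 - w ^ 2) +
            Complex.sqrt (1 - 1 / z ^ 2)) /
          (4 - w / z - z / w - z * w - 1 / (z * w)))) ∧
    -- the algorithm reaches every vertex of the half plane and returns the value of `GH` there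
    (∀ x y : ℤ, 0 ≤ y → Even (x + y) → ∀ a : ℝ, HalfPlaneAlg x y a ↔ a = GH x y) ∧
    -- the values are computable, in the exact form `(a + b √2) / 2 ^ n`
    (∃ f : ℤ × ℕ → ℤ × ℤ × ℕ, Computable f ∧ ∀ (x : ℤ) (y : ℕ),
      GH x y = (((f (x, y)).1 : ℝ) + ((f (x, y)).2.1 : ℝ) * √2) / 2 ^ (f (x, y)).2.2) ∧
    -- dyadic rationals with `√2` adjoined
    (∀ x y : ℤ, 0 ≤ y → GH x y ∈ Algebra.adjoin ℤ ({1 / 2, √2} : Set ℝ)) := by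
  refine ⟨fun v => (hasSum_killedWalk_slit v).summable, fun x hx => ?_, boundaryCurrent_zero,
    fun x hx => boundaryCurrent_pos hx, GH_harmonic, fun z hz => hasSum_boundaryCurrent_zpow hz,
    fun z hz => hasSum_GH_axis hz, GH_zero_add_two, GH_column_shift,
    fun z w hz hw => GH_first_quadrant hz hw, fun z w hz hw => GH_second_quadrant hz hw,
    fun x y hy h a => halfPlaneAlg_iff hy h a,
    ⟨exactValue, primrec_exactValue.to_comp, GH_eq_exactValue⟩, GH_mem_adjoin⟩
  rw [GH_axis, voltage_axis_neg hx]
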